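/- Let $L>0$ and $\mu>0$, and let $\Omega=(0,L)$, so $|\Omega|=L$. For $m_0\in(0,1)$ let $$\mathcal M_{m_0}(\Omega)=\Big\{m\in L^\infty(\Omega):\ 0\le m\le 1 \text{ a.e.},\ \frac1{|\Omega|}\int_\Omega m=m_0\Big\}.$$ For $m\in\mathcal M_{m_0}(\Omega)$ let $\theta_{m,\mu}\in H^1(\Omega)$ be the (unique) weak solution of $$\mu\theta''+\theta(m-\theta)=0\ \text{ in }\Omega,\qquad \theta'=0\ \text{ on }\partial\Omega,\qquad \theta\ge0,\ \theta\not\equiv0,$$ and put $F_\mu(m)=\int_\Omega\theta_{m,\mu}$. An optimal control is an $m\in\mathcal M_{m_0}(\Omega)$ that maximizes $F_\mu$ over $\mathcal M_{m_0}(\Omega)$. Theorem (Optimal control with small resource). There is a threshold $m_1=m_1(|\Omega|,\mu)\in(0,1)$ such that for every $m_0\in(0,m_1)$, with $b=m_0|\Omega|$, the two functions $x\mapsto\chi_{(0,b)}(x)$ and $x\mapsto\chi_{(0,b)}(|\Omega|-x)$ are optimal controls, and every optimal control equals one of them almost everywhere in $\Omega$. -/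

import Mathlib

open MeasureTheory Set
open scoped ContDiff ENNReal

noncomputable section

namespace LogisticControl

/-- Lebesgue measure on the open interval `Ω = (0, L)`. -/
def vol (L : ℝ) : Measure ℝ := volume.restrict (Ioo 0 L)

/-- `g` is the weak derivative of `u` on `(0, L)`. -/
def HasWeakDeriv (L : ℝ) (u g : ℝ → ℝ) : Prop :=
  ∀ φ : ℝ → ℝ, ContDiff ℝ ∞ φ → HasCompactSupport φ → tsupport φ ⊆ Ioo 0 L →
    ∫ x, u x * deriv φ x ∂(vol L) = -∫ x, g x * φ x ∂(vol L)

/-- `θ ∈ H¹(0, L)` is a nonnegative, nonzero weak solution of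
`μ θ'' + θ (m - θ) = 0` in `(0, L)` with `θ' = 0` at `0` and `L`. The test functions are
smooth up to the boundary and not required to vanish there, which encodes the Neumann condition. -/
def IsEquilibrium (L μ : ℝ) (m θ : ℝ → ℝ) : Prop :=
  MemLp θ 2 (vol L) ∧ (∀ᵐ x ∂(vol L), 0 ≤ θ x) ∧ ¬ (∀ᵐ x ∂(vol L), θ x = 0) ∧
    ∃ g : ℝ → ℝ, MemLp g 2 (vol L) ∧ HasWeakDeriv L θ g ∧
      ∀ φ : ℝ → ℝ, ContDiff ℝ ∞ φ →
        μ * ∫ x, g x * deriv φ x ∂(vol L) = ∫ x, θ x * (m x - θ x) * φ x ∂(vol L)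

open Classical in
/-- The equilibrium population density `θ_{m,μ}`, determined almost everywhere on `(0, L)`
(and `0` if there were no equilibrium, which does not occur for resources of positive mean). -/
def equilibrium (L μ : ℝ) (m : ℝ → ℝ) : ℝ → ℝ :=
  if h : ∃ θ, IsEquilibrium L μ m θ then h.choose else 0

/-- The total population `F_μ(m)`. -/
def totalPopulation (L μ : ℝ) (m : ℝ → ℝ) : ℝ :=
  ∫ x, equilibrium L μ m x ∂(vol L)

/-- The class of resources `m ∈ L^∞(0, L)` with `0 ≤ m ≤ 1` almost everywhere and mean `m₀`. -/
def resources (L m₀ : ℝ) : Set (ℝ → ℝ) :=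
  {m | MemLp m ∞ (vol L) ∧ (∀ᵐ x ∂(vol L), 0 ≤ m x ∧ m x ≤ 1) ∧
    1 / L * ∫ x, m x ∂(vol L) = m₀}

/-- `m` maximizes the total population among all resources of mean `m₀`. -/
def IsOptimalControl (L μ m₀ : ℝ) (m : ℝ → ℝ) : Prop :=
  m ∈ resources L m₀ ∧ IsMaxOn (totalPopulation L μ) (resources L m₀) m

/-- The characteristic function of `(0, b)`. -/
def chi (b : ℝ) : ℝ → ℝ := (Ioo 0 b).indicator fun _ => 1

end LogisticControl

end

noncomputable section

namespace LogisticControl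

/-! Write `b = m₀ L`, let `n` be the indicator of `(0, b)`, let `m` be a competitor, and let `ψ`,
`θ` be equilibria of `n`, `m`. The difference satisfies the exact linear equation `μ (ψ - θ)'' = (ψ
+ θ - n)(ψ - θ) - θ (n - m)`. If `P` solves the Neumann problem `μ P'' = (ψ + θ - n) P - κ`, then
Green's identity gives `κ ∫ (ψ - θ) = ∫ (n - m) θ P` (`IsAdjoint.mul_integral_sub`). No
linearization is involved, since the coefficient contains both equilibria. It remains to see that `κ
> 0` and that the switching function `h = θ P` lies above `h b` on `(0, b)` and below it on `(b,
L)`: then `(n - m)(h - h b) ≥ 0` pointwise, and since `n` and `m` have equal integrals, the bathtub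
principle gives `∫ θ ≤ ∫ ψ`, with equality only for `m = n` almost everywhere.

The small parameter is `e = m₀ L² / μ`. Equilibria equal `m₀` up to a relative error of order `e`,
while `P = 1 + O(e)` and `κ = m₀ (1 + O(e))`. On `(0, b)` the coefficient `ψ + θ - n` is close to
`-1`, so `P` falls steeply and `h` decreases (`strictAntiOn_mul`). On `(b, L)`, with `M` the
primitive of `m`, one has `μ h' = m₀ (2 m₀ x - b - M) + O(e m₀ b)`; integrating from `b` gives `h x
< h b`, provided that `m` has at least half of the maximal first moment `∫ M` (`mul_lt_of_mem_Ioc`).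
Either `m` or its reflection has this property, which is why there are exactly two optimizers.

Existence of `ψ` and of `P` comes from one contraction argument. Uniqueness of equilibria is not
needed: the comparison holds for every choice of equilibria, so applied to two equilibria of `n` it
shows that they have the same total. -/

/-! ### Calculus on the interval and the lemma of du Bois-Reymond -/

theorem integral_vol {L : ℝ} (hL : 0 < L) (f : ℝ → ℝ) :
    ∫ x, f x ∂(vol L) = ∫ x in (0 : ℝ)..L, f x := by
  rw [intervalIntegral.integral_of_le hL.le, integral_Ioc_eq_integral_Ioo, vol]

theorem integrable_vol_iff {L : ℝ} (hL : 0 < L) {f : ℝ → ℝ} :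
    Integrable f (vol L) ↔ IntervalIntegrable f volume 0 L := by
  rw [intervalIntegrable_iff_integrableOn_Ioo_of_le hL.le, vol, IntegrableOn]

theorem ae_vol_of_forall {L : ℝ} {p : ℝ → Prop} (h : ∀ x ∈ Ioo 0 L, p x) : ∀ᵐ x ∂(vol L), p x :=
  (ae_restrict_iff' measurableSet_Ioo).2 (Filter.Eventually.of_forall h)

instance isFiniteMeasure_vol (L : ℝ) : IsFiniteMeasure (vol L) := by
  unfold vol; infer_instance

/-- Integration by parts of a `C¹` function against an integrable function. -/
theorem integral_mul_eq_sub_integral_primitive {L : ℝ} {u u' f : ℝ → ℝ}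
    (hu : ∀ x, HasDerivAt u (u' x) x) (hu' : Continuous u') (hf : IntervalIntegrable f volume 0 L) :
    ∫ x in (0 : ℝ)..L, u x * f x =
      u L * (∫ x in (0 : ℝ)..L, f x) - ∫ x in (0 : ℝ)..L, u' x * ∫ t in (0 : ℝ)..x, f t := by
  have hderiv : deriv u = u' := funext fun x => (hu x).deriv
  have hC : ContDiff ℝ 1 u := by
    rw [contDiff_one_iff_deriv]
    exact ⟨fun x => (hu x).differentiableAt, hderiv ▸ hu'⟩
  have hac := hC.contDiffOn.absolutelyContinuousOnInterval (a := 0) (b := L)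
  have hG := hf.absolutelyContinuousOnInterval_intervalIntegral (c := 0) (by simp)
  have key := hac.integral_mul_deriv_eq_deriv_mul hG
  rw [hderiv] at key
  simp only [intervalIntegral.integral_same, mul_zero, sub_zero] at key
  rw [← key]
  apply intervalIntegral.integral_congr_ae
  filter_upwards [hf.ae_hasDerivAt_integral] with x hx hxm
  rw [(hx (uIoc_subset_uIcc hxm) 0 (by simp)).deriv]

/-- The primitive of a smooth function is smooth. -/
theorem contDiff_primitive {η : ℝ → ℝ} (hη : ContDiff ℝ ∞ η) :
    ContDiff ℝ ∞ (fun x => ∫ t in (0 : ℝ)..x, η t) ∧ deriv (fun x => ∫ t in (0 : ℝ)..x, η t) = η := by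
  have hd : ∀ x, HasDerivAt (fun x => ∫ t in (0 : ℝ)..x, η t) (η x) x := fun x =>
    (hη.continuous.integral_hasStrictDerivAt 0 x).hasDerivAt
  have hderiv : deriv (fun x => ∫ t in (0 : ℝ)..x, η t) = η := funext fun x => (hd x).deriv
  refine ⟨?_, hderiv⟩
  rw [contDiff_infty_iff_deriv]
  exact ⟨fun x => (hd x).differentiableAt, hderiv.symm ▸ hη⟩

/-- A compactly supported smooth function on `(0, L)` of integral zero is the derivative of another
one. -/
theorem exists_primitive_of_integral_eq_zero {L : ℝ} (hL : 0 < L) {η : ℝ → ℝ}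
    (hη : ContDiff ℝ ∞ η) (hc : HasCompactSupport η) (hs : tsupport η ⊆ Ioo 0 L)
    (h0 : ∫ x in (0 : ℝ)..L, η x = 0) :
    ∃ φ : ℝ → ℝ, ContDiff ℝ ∞ φ ∧ HasCompactSupport φ ∧ tsupport φ ⊆ Ioo 0 L ∧ deriv φ = η := by
  obtain ⟨α, β, hα, hβ, hαβ⟩ : ∃ α β : ℝ, 0 < α ∧ β < L ∧ tsupport η ⊆ Icc α β := by
    rcases (tsupport η).eq_empty_or_nonempty with he | hne
    · exact ⟨L / 2, L / 2, by linarith, by linarith, by simp [he]⟩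
    · refine ⟨sInf (tsupport η), sSup (tsupport η), (hs (hc.sInf_mem hne)).1,
        (hs (hc.sSup_mem hne)).2, fun x hx => ⟨csInf_le hc.bddBelow hx, le_csSup hc.bddAbove hx⟩⟩
  have hz : ∀ x, x ∉ Icc α β → η x = 0 := fun x hx =>
    image_eq_zero_of_notMem_tsupport fun h => hx (hαβ h)
  obtain ⟨h1, h2⟩ := contDiff_primitive hη
  have hsub : tsupport (fun x => ∫ t in (0 : ℝ)..x, η t) ⊆ Icc α β := by
    apply closure_minimal _ isClosed_Icc
    intro x hx
    by_contra hxn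
    apply hx
    have hint : ∀ a b, IntervalIntegrable η volume a b := fun a b =>
      hη.continuous.intervalIntegrable a b
    rcases not_and_or.1 hxn with h | h
    · simp only [not_le] at h
      have : EqOn η 0 (uIcc 0 x) := by
        intro t ht
        apply hz
        intro htα
        have : t ≤ max 0 x := ht.2
        rcases le_max_iff.1 this with h' | h' <;> linarith [htα.1]
      simp [intervalIntegral.integral_congr this]
    · simp only [not_le] at h
      have : EqOn η 0 (uIcc x L) := by
        intro t ht
        apply hz
        intro htα
        have : min x L ≤ t := ht.1
        rcases min_le_iff.1 this with h' | h' <;> linarith [htα.2]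
      have h3 := intervalIntegral.integral_add_adjacent_intervals (hint 0 x) (hint x L)
      rw [intervalIntegral.integral_congr this, h0] at h3
      simpa using h3
  exact ⟨_, h1, HasCompactSupport.of_support_subset_isCompact isCompact_Icc
    ((subset_tsupport _).trans hsub), hsub.trans (fun x hx => ⟨hα.trans_le hx.1, hx.2.trans_lt hβ⟩), h2⟩

/-- The lemma of du Bois-Reymond on `(0, L)`. -/
theorem ae_eq_const_of_integral_mul_deriv_eq_zero {L : ℝ} (hL : 0 < L) {w : ℝ → ℝ}
    (hw : Integrable w (vol L))
    (h : ∀ φ : ℝ → ℝ, ContDiff ℝ ∞ φ → HasCompactSupport φ → tsupport φ ⊆ Ioo 0 L →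
      ∫ x, w x * deriv φ x ∂(vol L) = 0) :
    ∃ c : ℝ, ∀ᵐ x ∂(vol L), w x = c := by
  obtain ⟨η, hηs, hηc, hη, hηr, hη1⟩ := exists_contDiff_tsupport_subset (n := ⊤)
    (Ioo_mem_nhds (show (0 : ℝ) < L / 2 by linarith) (show L / 2 < L by linarith))
  have hIpos : 0 < ∫ x in (0 : ℝ)..L, η x := by
    apply intervalIntegral.integral_pos hL hη.continuous.continuousOn
    · intro x _
      exact (hηr ⟨x, rfl⟩).1
    · exact ⟨L / 2, ⟨by linarith, by linarith⟩, by rw [hη1]; exact one_pos⟩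
  set I := ∫ x in (0 : ℝ)..L, η x with hI
  have hbdd : ∀ ζ : ℝ → ℝ, Continuous ζ → Integrable (fun x => w x * ζ x) (vol L) := by
    intro ζ hζ
    rw [integrable_vol_iff hL] at hw ⊢
    exact hw.mul_continuousOn hζ.continuousOn
  set c := (∫ x, w x * η x ∂(vol L)) / I with hc
  refine ⟨c, ?_⟩
  have key := isOpen_Ioo.ae_eq_zero_of_integral_contDiff_smul_eq_zero (U := Ioo 0 L) (μ := vol L)
    (f := fun x => w x - c) ((hw.sub (integrable_const c)).locallyIntegrable.locallyIntegrableOn _) ?_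
  · filter_upwards [key, ae_vol_of_forall (L := L) (p := fun x => x ∈ Ioo 0 L) fun x hx => hx]
      with x hx hx2
    linarith [hx hx2]
  intro ζ hζ hζc hζs
  set J := ∫ x in (0 : ℝ)..L, ζ x with hJ
  -- Subtracting a multiple of the fixed bump `η` makes the mean zero, so the hypothesis applies to
  -- a primitive. What is left over is exactly the constant `c`.
  have hsm : ContDiff ℝ ∞ (fun x => ζ x - J / I * η x) := hζ.sub (contDiff_const.mul hη)
  have hsub : tsupport (fun x => ζ x - J / I * η x) ⊆ tsupport ζ ∪ tsupport η := by
    apply closure_minimal _ ((isClosed_tsupport _).union (isClosed_tsupport _))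
    intro x hx
    by_contra hn
    simp only [mem_union, not_or] at hn
    apply hx
    simp [image_eq_zero_of_notMem_tsupport hn.1, image_eq_zero_of_notMem_tsupport hn.2]
  obtain ⟨φ, hφ, hφc, hφs, hφd⟩ := exists_primitive_of_integral_eq_zero hL hsm
    (HasCompactSupport.of_support_subset_isCompact (hζc.union hηc) ((subset_tsupport _).trans hsub))
    (hsub.trans (union_subset hζs hηs)) (by
      rw [intervalIntegral.integral_sub (hζ.continuous.intervalIntegrable _ _)
        ((hη.continuous.intervalIntegrable _ _).const_mul _),
        intervalIntegral.integral_const_mul, ← hI, ← hJ]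
      field_simp
      ring)
  have h1 := h φ hφ hφc hφs
  rw [hφd] at h1
  have e1 : ∀ x, w x * (ζ x - J / I * η x) = w x * ζ x - J / I * (w x * η x) := fun x => by ring
  simp only [e1] at h1
  rw [integral_sub (hbdd _ hζ.continuous) ((hbdd _ hη.continuous).const_mul _),
    integral_const_mul] at h1
  have e2 : ∀ x, ζ x • (w x - c) = w x * ζ x - c * ζ x := fun x => by rw [smul_eq_mul]; ring
  simp only [e2]
  have hζi : Integrable ζ (vol L) :=
    (integrable_vol_iff hL).2 (hζ.continuous.intervalIntegrable _ _)
  rw [integral_sub (hbdd _ hζ.continuous) (hζi.const_mul _), integral_const_mul,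
    integral_vol hL ζ, ← hJ, hc]
  rw [div_mul_eq_mul_div, mul_comm J] at h1
  rw [div_mul_eq_mul_div]
  exact h1

/-! ### Regularity of weak equilibria -/

/-- `θ` is a `C¹` solution, with derivative `θ'`, of the integrated form of the equation
`μ θ'' + θ (m - θ) = 0` on `[0, L]` with `θ' = 0` at `0` and `L`. -/
structure IsRegularEquilibrium (L μ : ℝ) (m θ θ' : ℝ → ℝ) : Prop where
  hasDerivAt : ∀ x, HasDerivAt θ (θ' x) x
  continuous_deriv : Continuous θ'
  deriv_eq : ∀ x ∈ Icc 0 L, μ * θ' x = ∫ t in (0 : ℝ)..x, θ t * (θ t - m t)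
  integral_eq : ∫ t in (0 : ℝ)..L, θ t * (θ t - m t) = 0
  nonneg : ∀ x ∈ Icc 0 L, 0 ≤ θ x
  exists_pos : ∃ x ∈ Icc 0 L, 0 < θ x

theorem IsRegularEquilibrium.continuous {L μ : ℝ} {m θ θ' : ℝ → ℝ}
    (h : IsRegularEquilibrium L μ m θ θ') : Continuous θ :=
  continuous_iff_continuousAt.2 fun x => (h.hasDerivAt x).continuousAt

/-- Two functions that agree almost everywhere on `(0, L)` have the same primitives there. -/
theorem integral_congr_of_ae_vol {L : ℝ} {f g : ℝ → ℝ} (h : ∀ᵐ x ∂(vol L), f x = g x) {x : ℝ}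
    (hx : x ∈ Icc 0 L) : ∫ t in (0 : ℝ)..x, f t = ∫ t in (0 : ℝ)..x, g t := by
  rw [intervalIntegral.integral_of_le hx.1, intervalIntegral.integral_of_le hx.1,
    integral_Ioc_eq_integral_Ioo, integral_Ioc_eq_integral_Ioo]
  exact integral_congr_ae (ae_restrict_of_ae_restrict_of_subset
    (Ioo_subset_Ioo_right hx.2) h)

theorem forall_Icc_nonneg_of_ae {L : ℝ} (hL : 0 < L) {θ : ℝ → ℝ} (hθ : Continuous θ)
    (h : ∀ᵐ x ∂(vol L), 0 ≤ θ x) : ∀ x ∈ Icc 0 L, 0 ≤ θ x := by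
  have h1 : ∀ x ∈ Ioo 0 L, 0 ≤ θ x := by
    intro x hx
    by_contra hneg
    have hopen : IsOpen (Ioo 0 L ∩ {y | θ y < 0}) :=
      isOpen_Ioo.inter (isOpen_lt hθ continuous_const)
    have hpos := hopen.measure_pos volume ⟨x, hx, not_le.1 hneg⟩
    have h2 := (ae_restrict_iff' measurableSet_Ioo).1 h
    rw [ae_iff] at h2
    refine hpos.ne' (measure_mono_null ?_ h2)
    rintro y ⟨hy, hy2⟩
    simp only [mem_ofPred_eq, Classical.not_imp, not_le]
    exact ⟨hy, hy2⟩
  intro x hx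
  rw [← closure_Ioo hL.ne] at hx
  exact (isClosed_le continuous_const hθ).closure_subset_iff.2 (fun y hy => h1 y hy) hx

/-- A weak equilibrium has a regular representative. -/
theorem IsEquilibrium.exists_regular {L μ : ℝ} (hL : 0 < L) (hμ : 0 < μ) {m θ₀ : ℝ → ℝ}
    (hm : Measurable m) (hm01 : ∀ x, 0 ≤ m x ∧ m x ≤ 1) (h : IsEquilibrium L μ m θ₀) :
    ∃ θ θ' : ℝ → ℝ, IsRegularEquilibrium L μ m θ θ' ∧ ∀ᵐ x ∂(vol L), θ₀ x = θ x := by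
  obtain ⟨hθ₀, hnn, hnz, g, hg, hwd, hweak⟩ := h
  have hθi : Integrable θ₀ (vol L) := hθ₀.integrable (by norm_num)
  have hgi : Integrable g (vol L) := hg.integrable (by norm_num)
  have hfi : Integrable (fun x => θ₀ x * (m x - θ₀ x)) (vol L) := by
    have h1 : Integrable (fun x => m x * θ₀ x) (vol L) :=
      hθi.bdd_mul (c := 1) hm.aestronglyMeasurable (Filter.Eventually.of_forall fun x => by
        rw [Real.norm_eq_abs, abs_le]; constructor <;> linarith [(hm01 x).1, (hm01 x).2])
    have h2 := hθ₀.integrable_sq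
    exact (h1.sub h2).congr (Filter.Eventually.of_forall fun x => by simp; ring)
  set f := fun x => θ₀ x * (m x - θ₀ x) with hf
  have hFi : Integrable ((Ioo 0 L).indicator f) volume :=
    (integrable_indicator_iff measurableSet_Ioo).2 hfi
  set F := (Ioo 0 L).indicator f with hF
  have hFf : ∀ᵐ x ∂(vol L), F x = f x := ae_vol_of_forall fun x hx => indicator_of_mem hx f
  have hΦ : Continuous (fun x => ∫ t in (0 : ℝ)..x, F t) :=
    intervalIntegral.continuous_primitive (fun a b => hFi.intervalIntegrable) 0
  set Φ := fun x => ∫ t in (0 : ℝ)..x, F t with hΦd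
  have hF0 : ∫ x in (0 : ℝ)..L, F x = 0 := by
    rw [integral_congr_of_ae_vol hFf ⟨hL.le, le_rfl⟩, ← integral_vol hL]
    have := hweak (fun _ => 1) contDiff_const
    simpa using this.symm
  -- The test function is a primitive of an arbitrary `η`. Since test functions need not vanish at
  -- the endpoints, no constant of integration appears: this is the Neumann condition at `0`, and
  -- `hF0` is the one at `L`.
  have hgae : ∀ᵐ x ∂(vol L), μ * g x + Φ x = 0 := by
    have hint : Integrable (fun x => μ * g x + Φ x) (vol L) :=
      (hgi.const_mul μ).add ((integrable_vol_iff hL).2 (hΦ.intervalIntegrable _ _))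
    apply ae_eq_zero_of_integral_contDiff_smul_eq_zero hint.locallyIntegrable
    intro η hη _
    obtain ⟨hφ, hφd⟩ := contDiff_primitive hη
    set φ := fun x => ∫ t in (0 : ℝ)..x, η t
    have h1 := hweak φ hφ
    have hφ' : ∀ x, HasDerivAt φ (η x) x := fun x => by
      have := (hφ.differentiable (by simp) x).hasDerivAt
      rwa [hφd] at this
    have h2 := integral_mul_eq_sub_integral_primitive (L := L) hφ' hη.continuous
      hFi.intervalIntegrable
    rw [hF0, mul_zero, zero_sub, ← integral_vol hL, ← integral_vol hL] at h2
    have h3 : ∫ x, θ₀ x * (m x - θ₀ x) * φ x ∂(vol L) = ∫ x, φ x * F x ∂(vol L) := by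
      apply integral_congr_ae
      filter_upwards [hFf] with x hx
      rw [hx, mul_comm]
    rw [h3, h2, hφd] at h1
    have h4 : ∀ x, η x • (μ * g x + Φ x) = μ * (g x * η x) + η x * Φ x := fun x => by
      rw [smul_eq_mul]; ring
    simp only [h4]
    rw [integral_add, integral_const_mul, h1]
    · ring
    · exact Integrable.const_mul ((integrable_vol_iff hL).2
        (((integrable_vol_iff hL).1 hgi).mul_continuousOn hη.continuous.continuousOn)) μ
    · exact (integrable_vol_iff hL).2 ((hη.continuous.mul hΦ).intervalIntegrable _ _)
  set θ' := fun x => -(Φ x) / μ with hθ'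
  have hθ'c : Continuous θ' := hΦ.neg.div_const μ
  have hgθ' : ∀ᵐ x ∂(vol L), g x = θ' x := by
    filter_upwards [hgae] with x hx
    rw [hθ']
    field_simp
    linarith
  set Θ := fun x => ∫ t in (0 : ℝ)..x, θ' t with hΘ
  have hΘd : ∀ x, HasDerivAt Θ (θ' x) x := fun x =>
    (hθ'c.integral_hasStrictDerivAt 0 x).hasDerivAt
  have hΘc : Continuous Θ := continuous_iff_continuousAt.2 fun x => (hΘd x).continuousAt
  have hΘi : Integrable Θ (vol L) := (integrable_vol_iff hL).2 (hΘc.intervalIntegrable _ _)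
  obtain ⟨c, hc⟩ := ae_eq_const_of_integral_mul_deriv_eq_zero hL (hθi.sub hΘi) (by
    intro φ hφ hφc hφs
    have h1 := hwd φ hφ hφc hφs
    have hφ' : ∀ x, HasDerivAt φ (deriv φ x) x := fun x =>
      (hφ.differentiable (by simp) x).hasDerivAt
    have hφ'c : Continuous (deriv φ) := (hφ.continuous_deriv (by simp))
    have hφL : φ L = 0 := image_eq_zero_of_notMem_tsupport fun h => lt_irrefl _ (hφs h).2
    have h2 := integral_mul_eq_sub_integral_primitive (L := L) hφ' hφ'c
      (hθ'c.intervalIntegrable _ _)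
    rw [hφL, zero_mul, zero_sub, ← integral_vol hL, ← integral_vol hL] at h2
    have h3 : ∫ x, g x * φ x ∂(vol L) = ∫ x, φ x * θ' x ∂(vol L) := by
      apply integral_congr_ae
      filter_upwards [hgθ'] with x hx
      rw [hx, mul_comm]
    rw [h3, h2, neg_neg] at h1
    have h4 : ∀ x, (θ₀ - Θ) x * deriv φ x = θ₀ x * deriv φ x - deriv φ x * Θ x := fun x => by
      simp only [Pi.sub_apply]; ring
    simp only [h4]
    rw [integral_sub, h1]
    · ring
    · exact (integrable_vol_iff hL).2
        (((integrable_vol_iff hL).1 hθi).mul_continuousOn hφ'c.continuousOn)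
    · exact (integrable_vol_iff hL).2 ((hφ'c.mul hΘc).intervalIntegrable _ _))
  have hae : ∀ᵐ x ∂(vol L), θ₀ x = c + Θ x := by
    filter_upwards [hc] with x hx
    simp only [Pi.sub_apply] at hx
    linarith
  have hcont : Continuous (fun x => c + Θ x) := continuous_const.add hΘc
  have hFneg : ∀ x ∈ Icc 0 L,
      ∫ t in (0 : ℝ)..x, (c + Θ t) * (c + Θ t - m t) = -∫ t in (0 : ℝ)..x, F t := by
    intro x hx
    rw [← intervalIntegral.integral_neg]
    apply integral_congr_of_ae_vol _ hx
    filter_upwards [hFf, hae] with t h1 h2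
    rw [h1, ← h2, hf]
    ring
  refine ⟨fun x => c + Θ x, θ', ⟨fun x => (hΘd x).const_add c, hθ'c, ?_, ?_, ?_, ?_⟩, hae⟩
  · intro x hx
    rw [hFneg x hx, hθ']
    field_simp
    rfl
  · rw [hFneg L ⟨hL.le, le_rfl⟩, hF0, neg_zero]
  · apply forall_Icc_nonneg_of_ae hL hcont
    filter_upwards [hnn, hae] with x h1 h2
    rwa [← h2]
  · by_contra hno
    push Not at hno
    apply hnz
    filter_upwards [hnn, hae, ae_vol_of_forall (L := L) (p := fun x => x ∈ Ioo 0 L) fun x hx => hx]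
      with x h1 h2 h3
    have := hno x ⟨h3.1.le, h3.2.le⟩
    rw [← h2] at this
    exact le_antisymm this h1

/-! ### A priori bounds: equilibria are nearly constant -/

theorem integral_mem_Icc_of_nonneg {L : ℝ} {f : ℝ → ℝ} (hf : IntervalIntegrable f volume 0 L)
    (hnn : ∀ x ∈ Icc 0 L, 0 ≤ f x) {x : ℝ} (hx : x ∈ Icc 0 L) :
    ∫ t in (0 : ℝ)..x, f t ∈ Icc 0 (∫ t in (0 : ℝ)..L, f t) := by
  refine ⟨intervalIntegral.integral_nonneg hx.1 fun t ht => hnn t ⟨ht.1, ht.2.trans hx.2⟩, ?_⟩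
  refine intervalIntegral.integral_mono_interval le_rfl hx.1 hx.2 ?_ hf
  exact (ae_restrict_iff' measurableSet_Ioc).2
    (Filter.Eventually.of_forall fun t ht => hnn t ⟨ht.1.le, ht.2⟩)

theorem intervalIntegrable_of_measurable {m : ℝ → ℝ} (hm : Measurable m)
    (hm01 : ∀ x, 0 ≤ m x ∧ m x ≤ 1) (a b : ℝ) : IntervalIntegrable m volume a b := by
  refine (intervalIntegrable_const (c := (1 : ℝ))).mono_fun hm.aestronglyMeasurable ?_
  refine Filter.Eventually.of_forall fun x => ?_
  simpa [abs_of_nonneg (hm01 x).1] using (hm01 x).2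

/-- A function whose derivative is at most `C` in absolute value on `[0, L]` has oscillation at
most `C L` there. -/
theorem abs_sub_le_of_abs_deriv_le {L C : ℝ} (hC : 0 ≤ C) {u u' : ℝ → ℝ}
    (hu : ∀ x, HasDerivAt u (u' x) x) (hb : ∀ x ∈ Icc 0 L, |u' x| ≤ C) {x y : ℝ}
    (hx : x ∈ Icc 0 L) (hy : y ∈ Icc 0 L) : |u x - u y| ≤ C * L := by
  have h := (convex_Icc (0 : ℝ) L).norm_image_sub_le_of_norm_hasDerivWithin_le
    (fun z _ => (hu z).hasDerivWithinAt) (fun z hz => hb z hz) hy hx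
  refine h.trans (mul_le_mul_of_nonneg_left ?_ hC)
  rw [Real.norm_eq_abs, abs_le]
  constructor <;> linarith [hx.1, hx.2, hy.1, hy.2]

/-- Equilibria of small resources are nearly constant. -/
theorem IsRegularEquilibrium.abs_sub_le {L μ m₀ e : ℝ} (hL : 0 < L) (hμ : 0 < μ) (hm₀ : 0 < m₀)
    (he : m₀ * L ^ 2 = e * μ) (he' : e ≤ 1 / 10) {m θ θ' : ℝ → ℝ} (hm : Measurable m)
    (hm01 : ∀ x, 0 ≤ m x ∧ m x ≤ 1) (hmi : ∫ x in (0 : ℝ)..L, m x = m₀ * L)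
    (h : IsRegularEquilibrium L μ m θ θ') :
    ∀ x ∈ Icc 0 L, |θ x - m₀| ≤ 3 * e * m₀ := by
  have he0 : 0 < e := pos_of_mul_pos_left (he ▸ by positivity) hμ.le
  have hθc := h.continuous
  obtain ⟨y, hy, hmax⟩ := isCompact_Icc.exists_isMaxOn (nonempty_Icc.2 hL.le) hθc.continuousOn
  set T := θ y with hT
  have hle : ∀ x ∈ Icc 0 L, θ x ≤ T := fun x hx => hmax hx
  have hTpos : 0 < T := by
    obtain ⟨x, hx, hpos⟩ := h.exists_pos
    exact hpos.trans_le (hle x hx)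
  have him : ∀ a b, IntervalIntegrable m volume a b := intervalIntegrable_of_measurable hm hm01
  have hi1 : ∀ a b, IntervalIntegrable (fun x => θ x ^ 2) volume a b := fun a b =>
    (hθc.pow 2).intervalIntegrable a b
  have hi2 : ∀ a b, IntervalIntegrable (fun x => m x * θ x) volume a b := fun a b =>
    (him a b).mul_continuousOn hθc.continuousOn
  have hsplit : ∀ x, ∫ t in (0 : ℝ)..x, θ t * (θ t - m t) =
      (∫ t in (0 : ℝ)..x, θ t ^ 2) - ∫ t in (0 : ℝ)..x, m t * θ t := by
    intro x
    rw [← intervalIntegral.integral_sub (hi1 0 x) (hi2 0 x)]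
    congr 1; ext t; ring
  -- Integrating the equation gives `∫ θ² = ∫ m θ`. Hence `μ θ'` is a difference of two numbers in
  -- `[0, J]`, and `J ≤ T m₀ L` bounds the oscillation of `θ` by `e T`, relative to its maximum `T`.
  set J := ∫ t in (0 : ℝ)..L, θ t ^ 2 with hJ
  have hJm : ∫ t in (0 : ℝ)..L, m t * θ t = J := by
    have := h.integral_eq
    rw [hsplit] at this
    linarith
  have hJT : J ≤ T * (m₀ * L) := by
    rw [← hJm, ← hmi, ← intervalIntegral.integral_const_mul]
    refine intervalIntegral.integral_mono_on hL.le (hi2 0 L) ((him 0 L).const_mul T) fun x hx => ?_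
    rw [mul_comm]
    exact mul_le_mul_of_nonneg_right (hle x hx) (hm01 x).1
  have hderiv : ∀ x ∈ Icc 0 L, |θ' x| ≤ J / μ := by
    intro x hx
    have h1 := integral_mem_Icc_of_nonneg (hi1 0 L) (fun t _ => sq_nonneg _) hx
    have h2 := integral_mem_Icc_of_nonneg (hi2 0 L)
      (fun t ht => mul_nonneg (hm01 t).1 (h.nonneg t ht)) hx
    rw [hJm] at h2
    have h3 := h.deriv_eq x hx
    rw [hsplit] at h3
    rw [le_div_iff₀ hμ]
    nth_rw 1 [← abs_of_pos hμ]
    rw [← abs_mul, mul_comm, h3, abs_le]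
    constructor <;> linarith [h1.1, h1.2, h2.1, h2.2]
  have hJ0 : 0 ≤ J := intervalIntegral.integral_nonneg hL.le fun t _ => sq_nonneg _
  have hosc : ∀ x ∈ Icc 0 L, T * (1 - e) ≤ θ x := by
    intro x hx
    have h1 := abs_sub_le_of_abs_deriv_le (div_nonneg hJ0 hμ.le) h.hasDerivAt hderiv hy hx
    have h2 : J / μ * L ≤ T * e := by
      rw [div_mul_eq_mul_div, div_le_iff₀ hμ]
      calc J * L ≤ T * (m₀ * L) * L := mul_le_mul_of_nonneg_right hJT hL.le
        _ = T * (m₀ * L ^ 2) := by ring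
        _ = T * e * μ := by rw [he]; ring
    have h3 := (abs_le.1 h1).2
    linarith
  have hJlow : (T * (1 - e)) ^ 2 * L ≤ J := by
    have : ∫ t in (0 : ℝ)..L, (T * (1 - e)) ^ 2 ≤ J :=
      intervalIntegral.integral_mono_on hL.le (by simp) (hi1 0 L) fun x hx =>
        pow_le_pow_left₀ (mul_nonneg hTpos.le (by linarith)) (hosc x hx) 2
    simpa [mul_comm] using this
  have hJup : J ≤ T ^ 2 * L := by
    have : J ≤ ∫ t in (0 : ℝ)..L, T ^ 2 :=
      intervalIntegral.integral_mono_on hL.le (hi1 0 L) (by simp) fun x hx =>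
        pow_le_pow_left₀ (h.nonneg x hx) (hle x hx) 2
    simpa [mul_comm] using this
  have hJlow' : T * (1 - e) * (m₀ * L) ≤ J := by
    rw [← hJm, ← hmi, ← intervalIntegral.integral_const_mul]
    refine intervalIntegral.integral_mono_on hL.le ((him 0 L).const_mul _) (hi2 0 L) fun x hx => ?_
    rw [mul_comm]
    exact mul_le_mul_of_nonneg_left (hosc x hx) (hm01 x).1
  -- Comparing the upper and lower bounds for `J`, one pair from `∫ θ²` and one from `∫ m θ`, pins
  -- `T` to `m₀`.
  have hT1 : T * (1 - e) ^ 2 ≤ m₀ := by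
    have : (T * L) * (T * (1 - e) ^ 2) ≤ (T * L) * m₀ := by nlinarith
    exact le_of_mul_le_mul_left this (by positivity)
  have hT2 : (1 - e) * m₀ ≤ T := by
    have : (T * L) * ((1 - e) * m₀) ≤ (T * L) * T := by nlinarith
    exact le_of_mul_le_mul_left this (by positivity)
  have hT3 : T ≤ m₀ * (1 + 3 * e) := by
    have h1 : 1 ≤ (1 + 3 * e) * (1 - e) ^ 2 := by nlinarith [mul_pos he0 he0]
    calc T = T * 1 := by ring
      _ ≤ T * ((1 + 3 * e) * (1 - e) ^ 2) := mul_le_mul_of_nonneg_left h1 hTpos.le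
      _ = (T * (1 - e) ^ 2) * (1 + 3 * e) := by ring
      _ ≤ m₀ * (1 + 3 * e) := mul_le_mul_of_nonneg_right hT1 (by linarith)
  intro x hx
  rw [abs_le]
  have h1 := hosc x hx
  have h2 : (1 - e) * m₀ * (1 - e) ≤ T * (1 - e) :=
    mul_le_mul_of_nonneg_right hT2 (by linarith)
  constructor
  · nlinarith [mul_pos he0 hm₀, mul_pos (mul_pos he0 he0) hm₀]
  · linarith [hle x hx]

/-! ### A contraction principle and the adjoint problem -/

/-- A contraction principle for the equation `w'' = G w`, `w(0) = w'(0) = 0` on `[0, L]`, where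
`G` may depend on `w` in a nonlocal way. -/
theorem exists_eq_double_primitive {L c : ℝ} (hL : 0 < L) (hc : 0 ≤ c) (hcL : c * L ≤ 1 / 4)
    (G : (ℝ → ℝ) → ℝ → ℝ)
    (hint : ∀ u, Continuous u → (∀ x, |u x| ≤ 1 / 2) → ∀ a b, IntervalIntegrable (G u) volume a b)
    (h0 : ∀ x ∈ Icc 0 L, |∫ t in (0 : ℝ)..x, G (fun _ => 0) t| ≤ c)
    (hlip : ∀ u v, Continuous u → Continuous v → (∀ x, |u x| ≤ 1 / 2) → (∀ x, |v x| ≤ 1 / 2) →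
      ∀ d, (∀ x, |u x - v x| ≤ d) → ∀ x ∈ Icc 0 L,
        |(∫ t in (0 : ℝ)..x, G u t) - ∫ t in (0 : ℝ)..x, G v t| ≤ c * d) :
    ∃ w u u' : ℝ → ℝ, Continuous w ∧ (∀ x, |w x| ≤ 1 / 2) ∧ (∀ x ∈ Icc 0 L, w x = u x) ∧
      (∀ x, HasDerivAt u (u' x) x) ∧ (∀ x, u' x = ∫ t in (0 : ℝ)..x, G w t) ∧ Continuous u' ∧
      ∀ x ∈ Icc 0 L, |u x| ≤ 2 * (c * L) := by
  let D : (ℝ → ℝ) → ℝ → ℝ := fun u x => ∫ t in (0 : ℝ)..x, G u t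
  let H : (ℝ → ℝ) → ℝ → ℝ := fun u x => ∫ t in (0 : ℝ)..x, D u t
  -- Composing with the projection onto `[0, L]` makes the iterates bounded on all of `ℝ`, so that
  -- the ball of radius `1/2` in the sup norm is a complete space. The equation is then only claimed
  -- on `[0, L]`.
  let p : ℝ → ℝ := fun x => max 0 (min L x)
  have hp : ∀ x, p x ∈ Icc 0 L := fun x => ⟨le_max_left _ _, max_le hL.le (min_le_left _ _)⟩
  have hpc : Continuous p := continuous_const.max (continuous_const.min continuous_id)
  have hpx : ∀ x ∈ Icc 0 L, p x = x := fun x hx => by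
    simp only [p]; rw [min_eq_right hx.2, max_eq_right hx.1]
  have hDc : ∀ u, Continuous u → (∀ x, |u x| ≤ 1 / 2) → Continuous (D u) := fun u hu hb =>
    intervalIntegral.continuous_primitive (hint u hu hb) 0
  have hHd : ∀ u, Continuous u → (∀ x, |u x| ≤ 1 / 2) → ∀ x, HasDerivAt (H u) (D u x) x :=
    fun u hu hb x => ((hDc u hu hb).integral_hasStrictDerivAt 0 x).hasDerivAt
  have hHc : ∀ u, Continuous u → (∀ x, |u x| ≤ 1 / 2) → Continuous (H u) := fun u hu hb =>
    continuous_iff_continuousAt.2 fun x => (hHd u hu hb x).continuousAt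
  have hHlip : ∀ u v, Continuous u → Continuous v → (∀ x, |u x| ≤ 1 / 2) → (∀ x, |v x| ≤ 1 / 2) →
      ∀ d, 0 ≤ d → (∀ x, |u x - v x| ≤ d) → ∀ x ∈ Icc 0 L, |H u x - H v x| ≤ c * L * d := by
    intro u v hu hv hub hvb d hd huv x hx
    have h1 := abs_sub_le_of_abs_deriv_le (u := fun x => H u x - H v x) (mul_nonneg hc hd)
      (fun x => (hHd u hu hub x).sub (hHd v hv hvb x))
      (hlip u v hu hv hub hvb d huv) hx ⟨le_rfl, hL.le⟩
    simp only [H, intervalIntegral.integral_same, sub_zero] at h1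
    exact h1.trans_eq (by ring)
  have hH0 : ∀ x ∈ Icc 0 L, |H (fun _ => 0) x| ≤ c * L := by
    intro x hx
    have h1 := abs_sub_le_of_abs_deriv_le hc (hHd (fun _ => 0) continuous_const (by simp)) h0 hx
      ⟨le_rfl, hL.le⟩
    simpa only [H, intervalIntegral.integral_same, sub_zero] using h1
  have hHb : ∀ u, Continuous u → (∀ x, |u x| ≤ 1 / 2) → ∀ d, 0 ≤ d → (∀ x, |u x| ≤ d) →
      ∀ x ∈ Icc 0 L, |H u x| ≤ c * L * (1 + d) := by
    intro u hu hub d hd hud x hx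
    have h1 := hHlip u (fun _ => 0) hu continuous_const hub (by simp) d hd (by simpa using hud) x hx
    have h2 := hH0 x hx
    calc |H u x| = |(H u x - H (fun _ => 0) x) + H (fun _ => 0) x| := by ring_nf
      _ ≤ c * L * d + c * L := (abs_add_le _ _).trans (add_le_add h1 h2)
      _ = c * L * (1 + d) := by ring
  let X := Metric.closedBall (0 : BoundedContinuousFunction ℝ ℝ) (1 / 2)
  have hX : ∀ u : X, ∀ x, |(u : BoundedContinuousFunction ℝ ℝ) x| ≤ 1 / 2 := fun u x => by
    have h1 := (u : BoundedContinuousFunction ℝ ℝ).norm_coe_le_norm x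
    have h2 := u.2
    rw [mem_closedBall_zero_iff] at h2
    exact h1.trans h2
  have hHX : ∀ u : X, ∀ x, ‖H u (p x)‖ ≤ 1 / 2 := fun u x => by
    have := hHb u u.1.continuous (hX u) (1 / 2) (by norm_num) (hX u) (p x) (hp x)
    rw [Real.norm_eq_abs]
    linarith
  let Φ : X → X := fun u => ⟨BoundedContinuousFunction.ofNormedAddCommGroup (fun x => H u (p x))
    ((hHc u u.1.continuous (hX u)).comp hpc) (1 / 2) (hHX u), by
      rw [mem_closedBall_zero_iff]
      exact BoundedContinuousFunction.norm_ofNormedAddCommGroup_le _ (by norm_num) (hHX u)⟩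
  have hΦ : ContractingWith (1 / 2) Φ := by
    refine ⟨by rw [← NNReal.coe_lt_coe]; norm_num, LipschitzWith.of_dist_le_mul fun u v => ?_⟩
    rw [Subtype.dist_eq, BoundedContinuousFunction.dist_le (by positivity)]
    intro x
    have h1 := hHlip u v u.1.continuous v.1.continuous (hX u) (hX v) (dist u v) dist_nonneg
      (fun y => by
        rw [← Real.dist_eq]; exact BoundedContinuousFunction.dist_coe_le_dist y) (p x) (hp x)
    refine le_trans (b := c * L * dist u v) h1 ?_
    refine mul_le_mul_of_nonneg_right ?_ dist_nonneg
    norm_num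
    linarith
  have hcomp : CompleteSpace X := Metric.isClosed_closedBall.completeSpace_coe
  have hne : Nonempty X := ⟨⟨0, Metric.mem_closedBall_self (by norm_num)⟩⟩
  let w := ContractingWith.fixedPoint Φ hΦ
  have hw : Φ w = w := hΦ.fixedPoint_isFixedPt
  have hwx : ∀ x, H w (p x) = (w : BoundedContinuousFunction ℝ ℝ) x := fun x =>
    congrArg (fun v : X => (v : BoundedContinuousFunction ℝ ℝ) x) hw
  refine ⟨w.1, H w, D w, w.1.continuous, hX w, fun x hx => ?_, hHd w w.1.continuous (hX w),
    fun x => rfl, hDc w w.1.continuous (hX w), fun x hx => ?_⟩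
  · rw [← hwx x, hpx x hx]
  · have := hHb w w.1.continuous (hX w) (1 / 2) (by norm_num) (hX w) x hx
    exact this.trans (by nlinarith [mul_nonneg hc hL.le])

/-- Resources may be as large as `1` pointwise; only their integral `m₀ L` is small. All
perturbation estimates therefore use the `L¹` norm of the coefficient. -/
theorem abs_integral_mul_le {L A d : ℝ} {a f : ℝ → ℝ} (ha : IntervalIntegrable a volume 0 L)
    (hA : ∫ x in (0 : ℝ)..L, |a x| ≤ A) (hd : 0 ≤ d)
    (hfd : ∀ x ∈ Icc 0 L, |f x| ≤ d) {x : ℝ} (hx : x ∈ Icc 0 L) :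
    |∫ t in (0 : ℝ)..x, a t * f t| ≤ A * d := by
  have hax : IntervalIntegrable a volume 0 x :=
    ha.mono_set (uIcc_subset_uIcc_left (by rw [uIcc_of_le (hx.1.trans hx.2)]; exact hx))
  calc |∫ t in (0 : ℝ)..x, a t * f t| ≤ ∫ t in (0 : ℝ)..x, |a t| * d := by
        rw [← Real.norm_eq_abs]
        refine intervalIntegral.norm_integral_le_of_norm_le hx.1
          (Filter.Eventually.of_forall fun t ht => ?_) (hax.abs.mul_const d)
        rw [Real.norm_eq_abs, abs_mul]
        exact mul_le_mul_of_nonneg_left (hfd t ⟨ht.1.le, ht.2.trans hx.2⟩) (abs_nonneg _)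
    _ = (∫ t in (0 : ℝ)..x, |a t|) * d := intervalIntegral.integral_mul_const _ _
    _ ≤ A * d := mul_le_mul_of_nonneg_right
        ((integral_mem_Icc_of_nonneg ha.abs (fun t _ => abs_nonneg _) hx).2.trans hA) hd

/-- `P` is a `C¹` solution, with derivative `P'`, of the integrated form of the equation
`μ P'' = a P - κ` on `[0, L]` with `P' = 0` at `0` and `L`. -/
structure IsAdjoint (L μ : ℝ) (a P P' : ℝ → ℝ) (κ : ℝ) : Prop where
  hasDerivAt : ∀ x, HasDerivAt P (P' x) x
  continuous_deriv : Continuous P'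
  integral_eq : κ * L = ∫ x in (0 : ℝ)..L, a x * P x
  deriv_eq : ∀ x ∈ Icc 0 L, μ * P' x = (∫ t in (0 : ℝ)..x, a t * P t) - κ * x

theorem IsAdjoint.continuous {L μ κ : ℝ} {a P P' : ℝ → ℝ} (h : IsAdjoint L μ a P P' κ) :
    Continuous P :=
  continuous_iff_continuousAt.2 fun x => (h.hasDerivAt x).continuousAt

/-- The adjoint problem is solvable for a coefficient `a` that is small in `L¹`. -/
theorem exists_adjoint {L μ A : ℝ} (hL : 0 < L) (hμ : 0 < μ) {a : ℝ → ℝ}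
    (ha : ∀ s t, IntervalIntegrable a volume s t) (hA : ∫ x in (0 : ℝ)..L, |a x| ≤ A)
    (hAL : 2 * A / μ * L ≤ 1 / 4) :
    ∃ (P P' : ℝ → ℝ) (κ : ℝ), IsAdjoint L μ a P P' κ ∧
      ∀ x ∈ Icc 0 L, |P x - 1| ≤ 4 * A / μ * L := by
  have hA0 : 0 ≤ A := (intervalIntegral.integral_nonneg hL.le fun t _ => abs_nonneg _).trans hA
  have hLL : L ∈ Icc 0 L := ⟨hL.le, le_rfl⟩
  have hint : ∀ u, Continuous u → ∀ s t, IntervalIntegrable (fun x => a x * (1 + u x)) volume s t :=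
    fun u hu s t => (ha s t).mul_continuousOn (continuous_const.add hu).continuousOn
  have hprim : ∀ u : ℝ → ℝ, Continuous u → ∀ k x : ℝ,
      ∫ t in (0 : ℝ)..x, (a t * (1 + u t) - k) / μ =
        ((∫ t in (0 : ℝ)..x, a t * (1 + u t)) - k * x) / μ := by
    intro u hu k x
    rw [intervalIntegral.integral_div, intervalIntegral.integral_sub (hint u hu 0 x) (by simp)]
    simp [mul_comm]
  have hmean : ∀ S s x : ℝ, |S| ≤ s → x ∈ Icc 0 L → |S / L * x| ≤ s := by
    intro S s x hS hx
    rw [div_mul_eq_mul_div, mul_div_assoc, abs_mul]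
    have : |x / L| ≤ 1 := by
      rw [abs_of_nonneg (div_nonneg hx.1 hL.le), div_le_one hL]
      exact hx.2
    calc |S| * |x / L| ≤ |S| * 1 := mul_le_mul_of_nonneg_left this (abs_nonneg _)
      _ ≤ s := by simpa using hS
  obtain ⟨w, u, u', hwc, hwb, hwu, hu, hu', hu'c, hub⟩ := exists_eq_double_primitive hL
    (c := 2 * A / μ) (by positivity) hAL
    -- With `P = 1 + u` normalized by `P 0 = 1`, the constant `κ` is the mean of `a P`. Subtracting
    -- it makes `P'` vanish at `L`, so the Neumann problem becomes a nonlocal initial value problem.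
    -- Each of the two terms contributes one `A` to the constant `2 A / μ`.
    (fun r t => (a t * (1 + r t) - (∫ x in (0 : ℝ)..L, a x * (1 + r x)) / L) / μ)
    (fun r hr _ s t => ((hint r hr s t).sub (by simp)).div_const μ)
    (fun x hx => by
      rw [hprim _ continuous_const, abs_div, abs_of_pos hμ, div_le_div_iff_of_pos_right hμ]
      have h1 : ∀ y ∈ Icc 0 L, |∫ t in (0 : ℝ)..y, a t * (1 + 0)| ≤ A := fun y hy => by
        have := abs_integral_mul_le (ha 0 L) hA (f := fun _ => 1 + 0) zero_le_one (by simp) hy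
        simpa using this
      have h2 := hmean _ A x (h1 L hLL) hx
      have h3 := h1 x hx
      refine (abs_sub _ _).trans ?_
      simp only [add_zero, mul_one] at h2 h3 ⊢
      linarith)
    (fun u v hu hv hub hvb d hd x hx => by
      have hd0 : 0 ≤ d := (abs_nonneg _).trans (hd 0)
      rw [hprim u hu, hprim v hv, ← sub_div, abs_div, abs_of_pos hμ,
        show 2 * A / μ * d = 2 * A * d / μ by ring, div_le_div_iff_of_pos_right hμ]
      have h1 : ∀ y ∈ Icc 0 L, |(∫ t in (0 : ℝ)..y, a t * (1 + u t)) -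
          ∫ t in (0 : ℝ)..y, a t * (1 + v t)| ≤ A * d := fun y hy => by
        rw [← intervalIntegral.integral_sub (hint u hu 0 y) (hint v hv 0 y)]
        have := abs_integral_mul_le (ha 0 L) hA (f := fun t => u t - v t) hd0 (fun t _ => hd t) hy
        convert this using 4
        ring
      have h2 := hmean _ _ x (h1 L hLL) hx
      have h3 := h1 x hx
      rw [sub_div, sub_mul] at h2
      rw [abs_le] at h2 h3 ⊢
      constructor <;> linarith [h2.1, h2.2, h3.1, h3.2])
  have hcongr : ∀ x ∈ Icc 0 L,
      ∫ t in (0 : ℝ)..x, a t * (1 + w t) = ∫ t in (0 : ℝ)..x, a t * (1 + u t) := by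
    intro x hx
    apply intervalIntegral.integral_congr
    intro t ht
    rw [uIcc_of_le hx.1] at ht
    simp only
    rw [hwu t ⟨ht.1, ht.2.trans hx.2⟩]
  refine ⟨fun x => 1 + u x, u', (∫ x in (0 : ℝ)..L, a x * (1 + u x)) / L,
    ⟨fun x => (hu x).const_add 1, hu'c, div_mul_cancel₀ _ hL.ne', fun x hx => ?_⟩,
    fun x hx => ?_⟩
  · rw [hu' x, hprim w hwc, hcongr x hx, hcongr L hLL]
    field_simp
  · simp only [add_sub_cancel_left]
    exact (hub x hx).trans_eq (by ring)

/-! ### Existence of equilibria -/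

theorem memLp_vol_of_continuous {L : ℝ} {θ : ℝ → ℝ} (hθ : Continuous θ) (p : ℝ≥0∞) :
    MemLp θ p (vol L) := by
  obtain ⟨C, hC⟩ := (isCompact_Icc (a := (0 : ℝ)) (b := L)).exists_bound_of_continuousOn
    hθ.continuousOn
  exact MemLp.of_bound hθ.aestronglyMeasurable C
    (ae_vol_of_forall fun x hx => hC x ⟨hx.1.le, hx.2.le⟩)

theorem IsRegularEquilibrium.isEquilibrium {L μ : ℝ} (hL : 0 < L) {m θ θ' : ℝ → ℝ}
    (hm : Measurable m) (hm01 : ∀ x, 0 ≤ m x ∧ m x ≤ 1) (h : IsRegularEquilibrium L μ m θ θ') :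
    IsEquilibrium L μ m θ := by
  have hθc := h.continuous
  refine ⟨memLp_vol_of_continuous hθc 2,
    ae_vol_of_forall fun x hx => h.nonneg x ⟨hx.1.le, hx.2.le⟩, fun h0 => ?_, θ',
    memLp_vol_of_continuous h.continuous_deriv 2, fun φ hφ _ hφs => ?_, fun φ hφ => ?_⟩
  · obtain ⟨x, hx, hpos⟩ := h.exists_pos
    have := forall_Icc_nonneg_of_ae hL hθc.neg (by
      filter_upwards [h0] with y hy
      simp [hy]) x hx
    simp only [Pi.neg_apply] at this
    linarith
  · have hφL : φ L = 0 := image_eq_zero_of_notMem_tsupport fun h => lt_irrefl _ (hφs h).2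
    have hφ0 : φ 0 = 0 := image_eq_zero_of_notMem_tsupport fun h => lt_irrefl _ (hφs h).1
    rw [integral_vol hL, integral_vol hL, intervalIntegral.integral_mul_deriv_eq_deriv_mul
      (fun x _ => h.hasDerivAt x) (fun x _ => (hφ.differentiable (by simp) x).hasDerivAt)
      (h.continuous_deriv.intervalIntegrable _ _)
      ((hφ.continuous_deriv (by simp)).intervalIntegrable _ _), hφL, hφ0]
    ring
  · have hi : IntervalIntegrable (fun t => θ t * (θ t - m t)) volume 0 L :=
      ((hθc.intervalIntegrable _ _).sub
        (intervalIntegrable_of_measurable hm hm01 _ _)).continuousOn_mul hθc.continuousOn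
    have h1 := integral_mul_eq_sub_integral_primitive (L := L)
      (fun x => (hφ.differentiable (by simp) x).hasDerivAt) (hφ.continuous_deriv (by simp)) hi
    rw [h.integral_eq, mul_zero, zero_sub] at h1
    have h2 : ∫ x in (0 : ℝ)..L, deriv φ x * ∫ t in (0 : ℝ)..x, θ t * (θ t - m t) =
        μ * ∫ x in (0 : ℝ)..L, θ' x * deriv φ x := by
      rw [← intervalIntegral.integral_const_mul]
      apply intervalIntegral.integral_congr
      intro x hx
      rw [uIcc_of_le hL.le] at hx
      simp only
      rw [← h.deriv_eq x hx]
      ring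
    rw [integral_vol hL, integral_vol hL, ← h2, ← neg_eq_iff_eq_neg.2 h1,
      ← intervalIntegral.integral_neg]
    congr 1
    ext x
    ring

/-- Existence of an equilibrium for small resources. -/
theorem exists_isRegularEquilibrium {L μ m₀ e : ℝ} (hL : 0 < L) (hμ : 0 < μ) (hm₀ : 0 < m₀)
    (he : m₀ * L ^ 2 = e * μ) (he' : e ≤ 1 / 1000) {m : ℝ → ℝ} (hm : Measurable m)
    (hm01 : ∀ x, 0 ≤ m x ∧ m x ≤ 1) (hmi : ∫ x in (0 : ℝ)..L, m x = m₀ * L) :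
    ∃ θ θ' : ℝ → ℝ, IsRegularEquilibrium L μ m θ θ' := by
  have him : ∀ a b, IntervalIntegrable m volume a b := intervalIntegrable_of_measurable hm hm01
  have hLL : L ∈ Icc 0 L := ⟨hL.le, le_rfl⟩
  -- The ansatz is `θ = K (1 + u)` with `u 0 = 0`. The choice `K = N / Q` is forced by the
  -- solvability condition `∫ θ (θ - m) = 0`, that is `K² Q = K N`. The bound `|u| ≤ 1/2` keeps `Q`
  -- away from zero and `θ` positive.
  let N : (ℝ → ℝ) → ℝ := fun u => ∫ x in (0 : ℝ)..L, m x * (1 + u x)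
  let Q : (ℝ → ℝ) → ℝ := fun u => ∫ x in (0 : ℝ)..L, (1 + u x) ^ 2
  let K : (ℝ → ℝ) → ℝ := fun u => N u / Q u
  have hiN : ∀ u : ℝ → ℝ, Continuous u → ∀ s t, IntervalIntegrable (fun x => m x * (1 + u x)) volume s t :=
    fun u hu s t => (him s t).mul_continuousOn (continuous_const.add hu).continuousOn
  have hiQ : ∀ u : ℝ → ℝ, Continuous u → ∀ s t, IntervalIntegrable (fun x => (1 + u x) ^ 2) volume s t :=
    fun u hu s t => ((continuous_const.add hu).pow 2).intervalIntegrable s t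
  have hNlow : ∀ u, Continuous u → (∀ x, |u x| ≤ 1 / 2) → m₀ * L / 2 ≤ N u := by
    intro u hu hb
    rw [← hmi, ← intervalIntegral.integral_div]
    refine intervalIntegral.integral_mono_on hL.le ((him 0 L).div_const 2) (hiN u hu 0 L)
      fun x _ => ?_
    nlinarith [(abs_le.1 (hb x)).1, (hm01 x).1]
  have hNup : ∀ u, Continuous u → (∀ x, |u x| ≤ 1 / 2) → N u ≤ 3 / 2 * (m₀ * L) := by
    intro u hu hb
    rw [← hmi, ← intervalIntegral.integral_const_mul]
    refine intervalIntegral.integral_mono_on hL.le (hiN u hu 0 L) ((him 0 L).const_mul _)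
      fun x _ => ?_
    nlinarith [(abs_le.1 (hb x)).2, (hm01 x).1]
  have hQlow : ∀ u, Continuous u → (∀ x, |u x| ≤ 1 / 2) → L / 4 ≤ Q u := by
    intro u hu hb
    have : ∫ x in (0 : ℝ)..L, (1 / 4 : ℝ) ≤ Q u :=
      intervalIntegral.integral_mono_on hL.le (by simp) (hiQ u hu 0 L) fun x _ => by
        nlinarith [(abs_le.1 (hb x)).1]
    simp only [intervalIntegral.integral_const, smul_eq_mul] at this
    linarith
  have hKnn : ∀ u, Continuous u → (∀ x, |u x| ≤ 1 / 2) → 0 < K u := fun u hu hb =>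
    div_pos (lt_of_lt_of_le (by positivity) (hNlow u hu hb))
      (lt_of_lt_of_le (by positivity) (hQlow u hu hb))
  have hKQ : ∀ u, Continuous u → (∀ x, |u x| ≤ 1 / 2) → K u * Q u = N u := fun u hu hb =>
    div_mul_cancel₀ _ (lt_of_lt_of_le (by positivity) (hQlow u hu hb)).ne'
  have hKup : ∀ u, Continuous u → (∀ x, |u x| ≤ 1 / 2) → K u ≤ 6 * m₀ := by
    intro u hu hb
    have h1 := hKQ u hu hb
    have h2 := mul_le_mul_of_nonneg_left (hQlow u hu hb) (hKnn u hu hb).le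
    have h3 := hNup u hu hb
    have : K u * L ≤ 6 * m₀ * L := by linarith
    exact le_of_mul_le_mul_right this hL
  have hKlip : ∀ u v, Continuous u → Continuous v → (∀ x, |u x| ≤ 1 / 2) → (∀ x, |v x| ≤ 1 / 2) →
      ∀ d, 0 ≤ d → (∀ x, |u x - v x| ≤ d) → |K u - K v| ≤ 76 * m₀ * d := by
    intro u v hu hv hub hvb d hd huv
    have hN : |N u - N v| ≤ m₀ * L * d := by
      simp only [N]
      rw [← intervalIntegral.integral_sub (hiN u hu 0 L) (hiN v hv 0 L)]
      have := abs_integral_mul_le (him 0 L) (A := m₀ * L) (f := fun t => u t - v t)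
        (by rw [← hmi]; exact le_of_eq (by congr 1; ext x; exact abs_of_nonneg (hm01 x).1)) hd
        (fun t _ => huv t) hLL
      convert this using 4
      ring
    have hQ : |Q u - Q v| ≤ 3 * L * d := by
      simp only [Q]
      rw [← intervalIntegral.integral_sub (hiQ u hu 0 L) (hiQ v hv 0 L), ← Real.norm_eq_abs]
      refine (intervalIntegral.norm_integral_le_of_norm_le_const (C := 3 * d) fun x _ => ?_).trans_eq
        (by rw [sub_zero, abs_of_pos hL]; ring)
      rw [Real.norm_eq_abs, show (1 + u x) ^ 2 - (1 + v x) ^ 2 = (2 + u x + v x) * (u x - v x) by ring,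
        abs_mul]
      refine mul_le_mul ?_ (huv x) (abs_nonneg _) (by norm_num)
      rw [abs_le]
      constructor <;> linarith [(abs_le.1 (hub x)).1, (abs_le.1 (hub x)).2,
        (abs_le.1 (hvb x)).1, (abs_le.1 (hvb x)).2]
    have h1 : Q u * (K u - K v) = (N u - N v) - K v * (Q u - Q v) := by
      linear_combination hKQ u hu hub - hKQ v hv hvb
    have h2 : |Q u * (K u - K v)| ≤ m₀ * L * d + 6 * m₀ * (3 * L * d) := by
      rw [h1]
      refine (abs_sub _ _).trans (add_le_add hN ?_)
      rw [abs_mul, abs_of_pos (hKnn v hv hvb)]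
      exact mul_le_mul (hKup v hv hvb) hQ (abs_nonneg _) (by positivity)
    rw [abs_mul, abs_of_pos (lt_of_lt_of_le (by positivity) (hQlow u hu hub))] at h2
    have h3 := mul_le_mul_of_nonneg_right (hQlow u hu hub) (abs_nonneg (K u - K v))
    have : L * |K u - K v| ≤ L * (76 * m₀ * d) := by linarith
    exact le_of_mul_le_mul_left this hL
  have hiG : ∀ u, Continuous u → ∀ s t,
      IntervalIntegrable (fun x => (1 + u x) * (K u * (1 + u x) - m x)) volume s t := by
    intro u hu s t
    have := ((hiQ u hu s t).const_mul (K u)).sub (hiN u hu s t)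
    refine this.congr fun x _ => ?_
    ring
  obtain ⟨w, u, u', hwc, hwb, hwu, hu, hu', hu'c, -⟩ := exists_eq_double_primitive hL
    -- The Lipschitz bound is `189 m₀ + m t` pointwise: `76 · 9/4 = 171` from the variation of `K`,
    -- `6 · 3 = 18` from the square, and the resource itself. Integration gives `190 m₀ L`, and `190
    -- e ≤ 1/4`.
    (c := 190 * (m₀ * L) / μ) (by positivity)
    (by rw [div_mul_eq_mul_div, div_le_iff₀ hμ]; nlinarith)
    (fun r t => (1 + r t) * (K r * (1 + r t) - m t) / μ)
    (fun r hr _ s t => (hiG r hr s t).div_const μ)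
    (fun x hx => by
      have hK0 : K (fun _ => 0) = m₀ := by
        simp only [K, N, Q, add_zero, mul_one, one_pow, hmi]
        simp [hL.ne']
      rw [hK0, intervalIntegral.integral_div, abs_div, abs_of_pos hμ,
        div_le_div_iff_of_pos_right hμ]
      simp only [add_zero, mul_one, one_mul]
      rw [intervalIntegral.integral_sub (by simp) (him 0 x)]
      have h1 := integral_mem_Icc_of_nonneg (him 0 L) (fun t _ => (hm01 t).1) hx
      rw [hmi] at h1
      simp only [intervalIntegral.integral_const, smul_eq_mul, sub_zero]
      rw [abs_le]
      have h2 := mul_le_mul_of_nonneg_left hx.2 hm₀.le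
      have h3 := mul_nonneg hm₀.le hx.1
      have h4 := mul_pos hm₀ hL
      constructor <;> linarith [h1.1, h1.2])
    (fun u v hu hv hub hvb d hd x hx => by
      have hd0 : 0 ≤ d := (abs_nonneg _).trans (hd 0)
      rw [intervalIntegral.integral_div, intervalIntegral.integral_div, ← sub_div, abs_div,
        abs_of_pos hμ, div_mul_eq_mul_div, div_le_div_iff_of_pos_right hμ,
        ← intervalIntegral.integral_sub (hiG u hu 0 x) (hiG v hv 0 x), ← Real.norm_eq_abs]
      have hpt : ∀ t, ‖(1 + u t) * (K u * (1 + u t) - m t) - (1 + v t) * (K v * (1 + v t) - m t)‖ ≤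
          189 * m₀ * d + m t * d := by
        intro t
        rw [Real.norm_eq_abs, show (1 + u t) * (K u * (1 + u t) - m t) -
          (1 + v t) * (K v * (1 + v t) - m t) = (K u - K v) * (1 + u t) ^ 2 +
          K v * ((2 + u t + v t) * (u t - v t)) - m t * (u t - v t) by ring]
        have hut := abs_le.1 (hub t)
        have hvt := abs_le.1 (hvb t)
        have e1 : |(K u - K v) * (1 + u t) ^ 2| ≤ 76 * m₀ * d * (9 / 4) := by
          rw [abs_mul]
          refine mul_le_mul (hKlip u v hu hv hub hvb d hd0 hd) ?_ (abs_nonneg _) (by positivity)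
          rw [abs_of_nonneg (sq_nonneg _)]
          nlinarith
        have e2 : |K v * ((2 + u t + v t) * (u t - v t))| ≤ 6 * m₀ * (3 * d) := by
          rw [abs_mul, abs_mul, abs_of_pos (hKnn v hv hvb)]
          refine mul_le_mul (hKup v hv hvb) (mul_le_mul ?_ (hd t) (abs_nonneg _) (by norm_num))
            (by positivity) (by positivity)
          rw [abs_le]
          constructor <;> linarith [hut.1, hut.2, hvt.1, hvt.2]
        have e3 : |m t * (u t - v t)| ≤ m t * d := by
          rw [abs_mul, abs_of_nonneg (hm01 t).1]
          exact mul_le_mul_of_nonneg_left (hd t) (hm01 t).1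
        refine (abs_sub _ _).trans ((add_le_add ((abs_add_le _ _).trans (add_le_add e1 e2)) e3).trans ?_)
        linarith
      refine (intervalIntegral.norm_integral_le_of_norm_le hx.1
        (Filter.Eventually.of_forall fun t _ => hpt t)
        ((by simp : IntervalIntegrable (fun _ => 189 * m₀ * d) volume 0 x).add
          ((him 0 x).mul_const d))).trans ?_
      rw [intervalIntegral.integral_add (by simp) ((him 0 x).mul_const d),
        intervalIntegral.integral_mul_const d m]
      have h1 := (integral_mem_Icc_of_nonneg (him 0 L) (fun t _ => (hm01 t).1) hx).2
      rw [hmi] at h1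
      simp only [intervalIntegral.integral_const, smul_eq_mul, sub_zero]
      have h2 := mul_le_mul_of_nonneg_right h1 hd0
      have h3 := mul_le_mul_of_nonneg_right hx.2 (by positivity : 0 ≤ 189 * m₀ * d)
      linarith)
  have hKw := hKnn w hwc hwb
  have hcongr : ∀ x ∈ Icc 0 L, ∫ t in (0 : ℝ)..x, K w * (1 + u t) * (K w * (1 + u t) - m t) =
      K w * ∫ t in (0 : ℝ)..x, (1 + w t) * (K w * (1 + w t) - m t) := by
    intro x hx
    rw [← intervalIntegral.integral_const_mul]
    apply intervalIntegral.integral_congr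
    intro t ht
    rw [uIcc_of_le hx.1] at ht
    simp only
    rw [hwu t ⟨ht.1, ht.2.trans hx.2⟩]
    ring
  have hpos : ∀ x ∈ Icc 0 L, 0 < K w * (1 + u x) := fun x hx => by
    rw [← hwu x hx]
    exact mul_pos hKw (by linarith [(abs_le.1 (hwb x)).1])
  refine ⟨fun x => K w * (1 + u x), fun x => K w * u' x,
    ⟨fun x => ((hu x).const_add 1).const_mul _, continuous_const.mul hu'c, fun x hx => ?_, ?_,
      fun x hx => (hpos x hx).le, 0, ⟨le_rfl, hL.le⟩, hpos 0 ⟨le_rfl, hL.le⟩⟩⟩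
  · rw [hcongr x hx, hu' x, intervalIntegral.integral_div]
    field_simp
  · rw [hcongr L hLL]
    have h1 : ∫ t in (0 : ℝ)..L, (1 + w t) * (K w * (1 + w t) - m t) = K w * Q w - N w := by
      simp only [Q, N]
      rw [← intervalIntegral.integral_const_mul,
        ← intervalIntegral.integral_sub ((hiQ w hwc 0 L).const_mul _) (hiN w hwc 0 L)]
      congr 1; ext t; ring
    rw [h1, hKQ w hwc hwb]
    ring

/-! ### Green's identity for two equilibria -/

theorem measurable_chi (b : ℝ) : Measurable (chi b) :=
  measurable_const.indicator measurableSet_Ioo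

theorem chi_mem (b : ℝ) (x : ℝ) : 0 ≤ chi b x ∧ chi b x ≤ 1 := by
  unfold chi
  by_cases hx : x ∈ Ioo 0 b
  · simp [hx]
  · simp [hx]

theorem integral_chi {b x : ℝ} (hb : 0 ≤ b) (hx : 0 ≤ x) :
    ∫ t in (0 : ℝ)..x, chi b t = min x b := by
  rw [intervalIntegral.integral_of_le hx, integral_Ioc_eq_integral_Ioo, chi,
    setIntegral_indicator measurableSet_Ioo, Ioo_inter_Ioo]
  simp [hx, hb]

/-- The difference of two equilibria tested against the adjoint state. -/
theorem IsAdjoint.mul_integral_sub {L μ κ : ℝ} (hL : 0 < L) {m n θ θ' ψ ψ' P P' : ℝ → ℝ}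
    (hm : Measurable m) (hm01 : ∀ x, 0 ≤ m x ∧ m x ≤ 1)
    (hn : Measurable n) (hn01 : ∀ x, 0 ≤ n x ∧ n x ≤ 1)
    (hθ : IsRegularEquilibrium L μ m θ θ') (hψ : IsRegularEquilibrium L μ n ψ ψ')
    (hP : IsAdjoint L μ (fun x => ψ x + θ x - n x) P P' κ) :
    κ * ∫ x in (0 : ℝ)..L, (ψ x - θ x) = ∫ x in (0 : ℝ)..L, (n x - m x) * (θ x * P x) := by
  have him : ∀ a b, IntervalIntegrable m volume a b := intervalIntegrable_of_measurable hm hm01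
  have hin : ∀ a b, IntervalIntegrable n volume a b := intervalIntegrable_of_measurable hn hn01
  have hθc := hθ.continuous
  have hψc := hψ.continuous
  have hPc := hP.continuous
  have hdc : Continuous fun x => ψ x - θ x := hψc.sub hθc
  have hhc : Continuous fun x => θ x * P x := hθc.mul hPc
  have hi1 : ∀ a b, IntervalIntegrable (fun x => ψ x * (ψ x - n x)) volume a b := fun a b =>
    ((hψc.intervalIntegrable _ _).sub (hin a b)).continuousOn_mul hψc.continuousOn
  have hi2 : ∀ a b, IntervalIntegrable (fun x => θ x * (θ x - m x)) volume a b := fun a b =>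
    ((hθc.intervalIntegrable _ _).sub (him a b)).continuousOn_mul hθc.continuousOn
  have hi3 : ∀ a b, IntervalIntegrable (fun x => (ψ x + θ x - n x) * P x) volume a b := fun a b =>
    (((hψc.add hθc).intervalIntegrable a b).sub (hin a b)).mul_continuousOn hPc.continuousOn
  -- These are `f = μ (ψ - θ)''` and `g = μ P''`, both of mean zero by the Neumann conditions. Two
  -- integrations by parts give `∫ P f = ∫ (ψ - θ) g`, and `P f - (ψ - θ) g = κ (ψ - θ) - (n - m) θ
  -- P` pointwise.
  set f := fun x => ψ x * (ψ x - n x) - θ x * (θ x - m x) with hf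
  set g := fun x => (ψ x + θ x - n x) * P x - κ with hg
  have hfi : ∀ a b, IntervalIntegrable f volume a b := fun a b => (hi1 a b).sub (hi2 a b)
  have hgi : ∀ a b, IntervalIntegrable g volume a b := fun a b => (hi3 a b).sub (by simp)
  have hfp : ∀ x ∈ Icc 0 L, ∫ t in (0 : ℝ)..x, f t = μ * (ψ' x - θ' x) := fun x hx => by
    rw [intervalIntegral.integral_sub (hi1 0 x) (hi2 0 x), ← hψ.deriv_eq x hx, ← hθ.deriv_eq x hx]
    ring
  have hgp : ∀ x ∈ Icc 0 L, ∫ t in (0 : ℝ)..x, g t = μ * P' x := fun x hx => by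
    rw [intervalIntegral.integral_sub (hi3 0 x) (by simp), hP.deriv_eq x hx]
    simp [mul_comm]
  have hfL : ∫ t in (0 : ℝ)..L, f t = 0 := by
    rw [intervalIntegral.integral_sub (hi1 0 L) (hi2 0 L), hψ.integral_eq, hθ.integral_eq, sub_zero]
  have hgL : ∫ t in (0 : ℝ)..L, g t = 0 := by
    rw [intervalIntegral.integral_sub (hi3 0 L) (by simp), ← hP.integral_eq]
    simp [mul_comm]
  have k1 := integral_mul_eq_sub_integral_primitive hP.hasDerivAt hP.continuous_deriv (hfi 0 L)
  have k2 := integral_mul_eq_sub_integral_primitive (u := fun x => ψ x - θ x)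
    (fun x => (hψ.hasDerivAt x).sub (hθ.hasDerivAt x))
    (hψ.continuous_deriv.sub hθ.continuous_deriv) (hgi 0 L)
  rw [hfL, mul_zero, zero_sub] at k1
  rw [hgL, mul_zero, zero_sub] at k2
  have k3 : ∫ x in (0 : ℝ)..L, P x * f x = ∫ x in (0 : ℝ)..L, (ψ x - θ x) * g x := by
    rw [k1, k2]
    congr 1
    apply intervalIntegral.integral_congr
    intro x hx
    rw [uIcc_of_le hL.le] at hx
    simp only
    rw [hfp x hx, hgp x hx]
    ring
  rw [← sub_eq_zero, ← intervalIntegral.integral_sub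
    ((hfi 0 L).continuousOn_mul hPc.continuousOn)
    ((hgi 0 L).continuousOn_mul hdc.continuousOn)] at k3
  rw [← intervalIntegral.integral_const_mul, ← sub_eq_zero, ← intervalIntegral.integral_sub
    ((hdc.intervalIntegrable _ _).const_mul κ)
    (((hin 0 L).sub (him 0 L)).mul_continuousOn hhc.continuousOn), ← k3]
  congr 1
  ext x
  simp only [hf, hg]
  ring

/-! ### First-order expansions of equilibrium and adjoint state -/

theorem abs_integral_sub_const_mul_le {L k d : ℝ} {f : ℝ → ℝ} (hf : Continuous f)
    (hfd : ∀ x ∈ Icc 0 L, |f x - k| ≤ d) {x : ℝ} (hx : x ∈ Icc 0 L) :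
    |(∫ t in (0 : ℝ)..x, f t) - k * x| ≤ d * L := by
  have hd : 0 ≤ d := (abs_nonneg _).trans (hfd x hx)
  have h1 : (∫ t in (0 : ℝ)..x, f t) - k * x = ∫ t in (0 : ℝ)..x, (f t - k) := by
    rw [intervalIntegral.integral_sub (hf.intervalIntegrable _ _) (by simp)]
    simp [mul_comm]
  rw [h1, ← Real.norm_eq_abs]
  refine (intervalIntegral.norm_integral_le_of_norm_le_const (C := d) fun t ht => ?_).trans ?_
  · rw [uIoc_of_le hx.1] at ht
    exact hfd t ⟨ht.1.le, ht.2.trans hx.2⟩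
  · rw [sub_zero, abs_of_nonneg hx.1]
    exact mul_le_mul_of_nonneg_left hx.2 hd

/-- First-order expansion of the derivative of an equilibrium. -/
theorem IsRegularEquilibrium.abs_deriv_sub_le {L μ m₀ e : ℝ} (hm₀ : 0 < m₀)
    (he0 : 0 ≤ e) (he' : e ≤ 1 / 10000) {m θ θ' : ℝ → ℝ} (hm : Measurable m)
    (hm01 : ∀ x, 0 ≤ m x ∧ m x ≤ 1) (hmi : ∫ x in (0 : ℝ)..L, m x = m₀ * L)
    (h : IsRegularEquilibrium L μ m θ θ') (hθ : ∀ x ∈ Icc 0 L, |θ x - m₀| ≤ 3 * e * m₀)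
    {x : ℝ} (hx : x ∈ Icc 0 L) :
    |μ * θ' x - (m₀ ^ 2 * x - m₀ * ∫ t in (0 : ℝ)..x, m t)| ≤ 10 * e * m₀ * (m₀ * L) := by
  have him : ∀ a b, IntervalIntegrable m volume a b := intervalIntegrable_of_measurable hm hm01
  have hθc := h.continuous
  have hθ2 : Continuous fun x => θ x ^ 2 := hθc.pow 2
  have hi1 : IntervalIntegrable (fun x => θ x ^ 2) volume 0 x :=
    hθ2.intervalIntegrable 0 x
  have hi2 : IntervalIntegrable (fun x => m x * θ x) volume 0 x :=
    (him 0 x).mul_continuousOn hθc.continuousOn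
  have hsplit : ∫ t in (0 : ℝ)..x, θ t * (θ t - m t) =
      (∫ t in (0 : ℝ)..x, θ t ^ 2) - ∫ t in (0 : ℝ)..x, m t * θ t := by
    rw [← intervalIntegral.integral_sub hi1 hi2]
    congr 1; ext t; ring
  -- The constant `7 = 3 · 7/3` bounds the error in `θ²`; the error in `m θ` adds `3`, for a total
  -- of `10`.
  have h1 := abs_integral_sub_const_mul_le (k := m₀ ^ 2) (d := 7 * e * m₀ * m₀) hθ2
    (fun t ht => by
      rw [show θ t ^ 2 - m₀ ^ 2 = (θ t - m₀) * (θ t + m₀) by ring, abs_mul]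
      have h3 := hθ t ht
      have h2 : |θ t + m₀| ≤ (7 / 3) * m₀ := by
        rw [abs_le] at h3 ⊢
        constructor <;> nlinarith
      refine (mul_le_mul h3 h2 (abs_nonneg _) (by positivity)).trans_eq (by ring)) hx
  have h2 := abs_integral_mul_le (him 0 L) (A := m₀ * L) (f := fun t => θ t - m₀)
    (by rw [← hmi]; exact le_of_eq (by congr 1; ext x; exact abs_of_nonneg (hm01 x).1))
    (by positivity) hθ hx
  have h3 : ∫ t in (0 : ℝ)..x, m t * (θ t - m₀) =
      (∫ t in (0 : ℝ)..x, m t * θ t) - m₀ * ∫ t in (0 : ℝ)..x, m t := by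
    rw [← intervalIntegral.integral_const_mul, ← intervalIntegral.integral_sub hi2
      ((him 0 x).const_mul _)]
    congr 1; ext t; ring
  rw [h3] at h2
  rw [h.deriv_eq x hx, hsplit]
  rw [abs_le] at h1 h2 ⊢
  constructor <;> linarith [h1.1, h1.2, h2.1, h2.2]

/-- First-order expansion of the adjoint state. -/
theorem IsAdjoint.abs_deriv_sub_le {L μ m₀ e κ : ℝ} (hL : 0 < L) (hm₀ : 0 < m₀)
    (he0 : 0 ≤ e) {n θ ψ P P' : ℝ → ℝ} (hn : Measurable n)
    (hn01 : ∀ x, 0 ≤ n x ∧ n x ≤ 1) (hni : ∫ x in (0 : ℝ)..L, n x = m₀ * L)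
    (hθc : Continuous θ) (hψc : Continuous ψ)
    (hθ : ∀ x ∈ Icc 0 L, |θ x - m₀| ≤ 3 * e * m₀) (hψ : ∀ x ∈ Icc 0 L, |ψ x - m₀| ≤ 3 * e * m₀)
    (hA : ∫ x in (0 : ℝ)..L, |ψ x + θ x - n x| ≤ 5 * (m₀ * L))
    (hP : IsAdjoint L μ (fun x => ψ x + θ x - n x) P P' κ)
    (hP1 : ∀ x ∈ Icc 0 L, |P x - 1| ≤ 20 * e) :
    |κ - m₀| ≤ 106 * e * m₀ ∧ ∀ x ∈ Icc 0 L,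
      |μ * P' x - (m₀ * x - ∫ t in (0 : ℝ)..x, n t)| ≤ 212 * e * (m₀ * L) := by
  have hin : ∀ a b, IntervalIntegrable n volume a b := intervalIntegrable_of_measurable hn hn01
  have hPc := hP.continuous
  have hsc : Continuous fun x => ψ x + θ x := hψc.add hθc
  have hai : ∀ a b, IntervalIntegrable (fun x => ψ x + θ x - n x) volume a b := fun a b =>
    (hsc.intervalIntegrable a b).sub (hin a b)
  -- Replacing `P` by `1` costs `5 · 20 = 100`, and replacing `ψ + θ` by `2 m₀` costs `6`. The error
  -- of `κ`, read off at `x = L`, doubles the total to `212` in the bound for `μ P'`.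
  have hexp : ∀ x ∈ Icc 0 L, |(∫ t in (0 : ℝ)..x, (ψ t + θ t - n t) * P t) -
      (2 * m₀ * x - ∫ t in (0 : ℝ)..x, n t)| ≤ 106 * e * (m₀ * L) := by
    intro x hx
    have h1 := abs_integral_mul_le (hai 0 L) hA (f := fun t => P t - 1) (by positivity) hP1 hx
    have h2 : ∫ t in (0 : ℝ)..x, (ψ t + θ t - n t) * (P t - 1) =
        (∫ t in (0 : ℝ)..x, (ψ t + θ t - n t) * P t) -
          ((∫ t in (0 : ℝ)..x, (ψ t + θ t)) - ∫ t in (0 : ℝ)..x, n t) := by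
      rw [← intervalIntegral.integral_sub (hsc.intervalIntegrable _ _) (hin 0 x),
        ← intervalIntegral.integral_sub ((hai 0 x).mul_continuousOn hPc.continuousOn) (hai 0 x)]
      congr 1; ext t; ring
    have h3 := abs_integral_sub_const_mul_le (k := 2 * m₀) (d := 6 * e * m₀) hsc
      (fun t ht => by
        have h4 := hψ t ht
        have h5 := hθ t ht
        rw [abs_le] at h4 h5 ⊢
        constructor <;> linarith [h4.1, h4.2, h5.1, h5.2]) hx
    rw [h2] at h1
    rw [abs_le] at h1 h3 ⊢
    constructor <;> linarith [h1.1, h1.2, h3.1, h3.2]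
  have hκ : |κ - m₀| ≤ 106 * e * m₀ := by
    have h1 := hexp L ⟨hL.le, le_rfl⟩
    rw [← hP.integral_eq, hni, show κ * L - (2 * m₀ * L - m₀ * L) = (κ - m₀) * L by ring, abs_mul,
      abs_of_pos hL] at h1
    exact le_of_mul_le_mul_right (h1.trans_eq (by ring)) hL
  refine ⟨hκ, fun x hx => ?_⟩
  have h1 := hexp x hx
  have h2 : |(κ - m₀) * x| ≤ 106 * e * m₀ * L := by
    rw [abs_mul, abs_of_nonneg hx.1]
    exact mul_le_mul hκ hx.2 hx.1 (by positivity)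
  rw [hP.deriv_eq x hx]
  rw [abs_le] at h1 h2 ⊢
  constructor <;> linarith [h1.1, h1.2, h2.1, h2.2]

/-- The product rule for the first-order expansions of an equilibrium and an adjoint state. -/
theorem abs_deriv_mul_sub_le {m₀ e b p q t P X Y : ℝ} (hm₀ : 0 < m₀) (he0 : 0 ≤ e)
    (he' : e ≤ 1 / 10000) (hb : 0 ≤ b) (ht : |t - m₀| ≤ 3 * e * m₀) (hP : |P - 1| ≤ 20 * e)
    (hX : |X| ≤ b) (hY : |Y| ≤ b) (hp : |p - m₀ * X| ≤ 10 * e * m₀ * b)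
    (hq : |q - Y| ≤ 212 * e * b) :
    |p * P + t * q - m₀ * (X + Y)| ≤ 500 * e * m₀ * b := by
  have hP2 : |P| ≤ 2 := by
    rw [abs_le] at hP ⊢
    constructor <;> linarith [hP.1, hP.2]
  have ht2 : |t| ≤ 2 * m₀ := by
    rw [abs_le] at ht ⊢
    constructor <;> nlinarith [ht.1, ht.2]
  have e1 : |(p - m₀ * X) * P| ≤ 10 * e * m₀ * b * 2 := by
    rw [abs_mul]; exact mul_le_mul hp hP2 (abs_nonneg _) (by positivity)
  have e2 : |m₀ * X * (P - 1)| ≤ m₀ * b * (20 * e) := by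
    rw [abs_mul, abs_mul, abs_of_pos hm₀]
    exact mul_le_mul (mul_le_mul_of_nonneg_left hX hm₀.le) hP (abs_nonneg _) (by positivity)
  have e3 : |t * (q - Y)| ≤ 2 * m₀ * (212 * e * b) := by
    rw [abs_mul]; exact mul_le_mul ht2 hq (abs_nonneg _) (by positivity)
  have e4 : |(t - m₀) * Y| ≤ 3 * e * m₀ * b := by
    rw [abs_mul]; exact mul_le_mul ht hY (abs_nonneg _) (by positivity)
  have hpos : 0 ≤ e * m₀ * b := by positivity
  rw [show p * P + t * q - m₀ * (X + Y) =
    (p - m₀ * X) * P + m₀ * X * (P - 1) + t * (q - Y) + (t - m₀) * Y by ring]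
  rw [abs_le] at *
  constructor <;> linarith [e1.1, e1.2, e2.1, e2.2, e3.1, e3.2, e4.1, e4.2]

/-! ### Shape of the switching function -/

/-- The switching function `θ P` decreases on `[0, b]`. -/
theorem strictAntiOn_mul {L μ m₀ e κ b : ℝ} (hμ : 0 < μ) (hm₀ : 0 < m₀)
    (hm₀' : m₀ ≤ 1 / 10000) (he' : e ≤ 1 / 10000) (hbL : b ≤ L) {m θ θ' ψ P P' : ℝ → ℝ}
    (hm : Measurable m) (hm01 : ∀ x, 0 ≤ m x ∧ m x ≤ 1) (hθ : IsRegularEquilibrium L μ m θ θ')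
    (hψc : Continuous ψ) (hP : IsAdjoint L μ (fun x => ψ x + θ x - chi b x) P P' κ) (hκ : 0 ≤ κ)
    (hθe : ∀ x ∈ Icc 0 L, |θ x - m₀| ≤ 3 * e * m₀) (hψe : ∀ x ∈ Icc 0 L, |ψ x - m₀| ≤ 3 * e * m₀)
    (hP1 : ∀ x ∈ Icc 0 L, |P x - 1| ≤ 20 * e) :
    StrictAntiOn (fun x => θ x * P x) (Icc 0 b) := by
  have hθc := hθ.continuous
  have hPc := hP.continuous
  have him : ∀ a b, IntervalIntegrable m volume a b := intervalIntegrable_of_measurable hm hm01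
  have hic : ∀ s t, IntervalIntegrable (chi b) volume s t :=
    intervalIntegrable_of_measurable (measurable_chi b) (chi_mem b)
  have hsmall : 3 * e * m₀ ≤ m₀ / 2 := by nlinarith
  apply strictAntiOn_of_deriv_neg (convex_Icc 0 b) (hθc.mul hPc).continuousOn
  intro x hx
  rw [interior_Icc] at hx
  have hxL : x ∈ Icc 0 L := ⟨hx.1.le, hx.2.le.trans hbL⟩
  rw [((hθ.hasDerivAt x).mul (hP.hasDerivAt x)).deriv]
  -- The expansions have errors that do not vanish as `x` tends to `0`. Here both derivatives are
  -- instead bounded by multiples of `x`: the possible growth of `θ` is of order `m₀² x`, and loses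
  -- to the decay `θ P'` of order `m₀ x`.
  have h1 : μ * θ' x ≤ 4 * m₀ ^ 2 * x := by
    rw [hθ.deriv_eq x hxL]
    have : ∫ t in (0 : ℝ)..x, θ t * (θ t - m t) ≤ ∫ t in (0 : ℝ)..x, 4 * m₀ ^ 2 := by
      refine intervalIntegral.integral_mono_on hx.1.le
        (((hθc.intervalIntegrable _ _).sub (him 0 x)).continuousOn_mul hθc.continuousOn) (by simp)
        fun t ht => ?_
      have htL : t ∈ Icc 0 L := ⟨ht.1, ht.2.trans hxL.2⟩
      have h2 := hθ.nonneg t htL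
      have h3 := (abs_le.1 (hθe t htL)).2
      have h4 := mul_nonneg h2 (hm01 t).1
      nlinarith
    simp only [intervalIntegral.integral_const, smul_eq_mul, sub_zero] at this
    linarith
  have h2 : μ * P' x ≤ -x / 4 := by
    rw [hP.deriv_eq x hxL]
    have : ∫ t in (0 : ℝ)..x, (ψ t + θ t - chi b t) * P t ≤ ∫ t in (0 : ℝ)..x, (-1 / 4 : ℝ) := by
      refine intervalIntegral.integral_mono_on_of_le_Ioo hx.1.le
        ((((hψc.add hθc).intervalIntegrable 0 x).sub (hic 0 x)).mul_continuousOn hPc.continuousOn)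
        (by simp) fun t ht => ?_
      have htL : t ∈ Icc 0 L := ⟨ht.1.le, ht.2.le.trans hxL.2⟩
      have hχ : chi b t = 1 := indicator_of_mem (show t ∈ Ioo 0 b from ⟨ht.1, ht.2.trans hx.2⟩) _
      have h3 := (abs_le.1 (hθe t htL)).2
      have h4 := (abs_le.1 (hψe t htL)).2
      have h5 := (abs_le.1 (hP1 t htL)).1
      rw [hχ]
      nlinarith
    simp only [intervalIntegral.integral_const, smul_eq_mul, sub_zero] at this
    linarith [mul_nonneg hκ hx.1.le]
  have h3 : P x ≤ 2 := by linarith [(abs_le.1 (hP1 x hxL)).2]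
  have h4 : 0 ≤ P x := by linarith [(abs_le.1 (hP1 x hxL)).1]
  have h5 : m₀ / 2 ≤ θ x := by linarith [(abs_le.1 (hθe x hxL)).1]
  have h6 : μ * θ' x * P x ≤ 8 * m₀ ^ 2 * x := by
    calc μ * θ' x * P x ≤ 4 * m₀ ^ 2 * x * P x := mul_le_mul_of_nonneg_right h1 h4
      _ ≤ 4 * m₀ ^ 2 * x * 2 := mul_le_mul_of_nonneg_left h3 (by have := hx.1; positivity)
      _ = 8 * m₀ ^ 2 * x := by ring
  have h7 : θ x * (μ * P' x) ≤ -(m₀ * x) / 8 := by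
    have := mul_le_mul_of_nonneg_left h2 (by linarith : 0 ≤ θ x)
    have h8 := mul_le_mul_of_nonneg_right h5 hx.1.le
    linarith
  have h8 : 8 * m₀ ^ 2 * x < m₀ * x / 8 := by
    have := mul_pos hm₀ hx.1
    nlinarith
  have h9 : μ * (θ' x * P x + θ x * P' x) < 0 := by linarith
  exact (pos_iff_neg_of_mul_neg h9).1 hμ

/-- The switching function `θ P` is smaller on `(b, L]` than at `b`, if the resource is mostly
in the left half. -/
theorem mul_lt_of_mem_Ioc {L μ m₀ e κ : ℝ} (hL : 0 < L) (hμ : 0 < μ) (hm₀ : 0 < m₀)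
    (hm₀' : m₀ ≤ 1 / 10000) (he0 : 0 ≤ e) (he' : e ≤ 1 / 10000) {m θ θ' ψ P P' : ℝ → ℝ}
    (hm : Measurable m) (hm01 : ∀ x, 0 ≤ m x ∧ m x ≤ 1) (hmi : ∫ x in (0 : ℝ)..L, m x = m₀ * L)
    (hleft : m₀ * L ^ 2 / 2 ≤ ∫ x in (0 : ℝ)..L, ∫ t in (0 : ℝ)..x, m t)
    (hθ : IsRegularEquilibrium L μ m θ θ') (hψc : Continuous ψ)
    (hP : IsAdjoint L μ (fun x => ψ x + θ x - chi (m₀ * L) x) P P' κ)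
    (hA : ∫ x in (0 : ℝ)..L, |ψ x + θ x - chi (m₀ * L) x| ≤ 5 * (m₀ * L))
    (hθe : ∀ x ∈ Icc 0 L, |θ x - m₀| ≤ 3 * e * m₀) (hψe : ∀ x ∈ Icc 0 L, |ψ x - m₀| ≤ 3 * e * m₀)
    (hP1 : ∀ x ∈ Icc 0 L, |P x - 1| ≤ 20 * e) {x : ℝ} (hx : x ∈ Ioc (m₀ * L) L) :
    θ x * P x < θ (m₀ * L) * P (m₀ * L) := by
  have hb0 : 0 < m₀ * L := by positivity
  have hbL : m₀ * L ≤ L / 10000 := by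
    have := mul_le_mul_of_nonneg_right hm₀' hL.le
    linarith
  have hni : ∫ x in (0 : ℝ)..L, chi (m₀ * L) x = m₀ * L := by
    rw [integral_chi hb0.le hL.le, min_eq_right (by linarith)]
  have him : ∀ a b, IntervalIntegrable m volume a b := intervalIntegrable_of_measurable hm hm01
  have hMc : Continuous fun x => ∫ t in (0 : ℝ)..x, m t :=
    intervalIntegral.continuous_primitive him 0
  have hMb : ∀ x ∈ Icc 0 L, (∫ t in (0 : ℝ)..x, m t) ∈ Icc 0 (m₀ * L) := fun x hx => by
    rw [← hmi]
    exact integral_mem_Icc_of_nonneg (him 0 L) (fun t _ => (hm01 t).1) hx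
  set M := fun x => ∫ t in (0 : ℝ)..x, m t with hM
  set b := m₀ * L with hb
  have hderiv : ∀ y ∈ Icc b L,
      μ * (θ' y * P y + θ y * P' y) ≤ m₀ * (2 * m₀ * y - b - M y) + 500 * e * m₀ * b := by
    intro y hy
    have hyL : y ∈ Icc 0 L := ⟨hb0.le.trans hy.1, hy.2⟩
    have h1 := hθ.abs_deriv_sub_le hm₀ he0 he' hm hm01 hmi hθe hyL
    have h2 := (hP.abs_deriv_sub_le hL hm₀ he0 (measurable_chi b) (chi_mem b) hni hθ.continuous hψc
      hθe hψe hA hP1).2 y hyL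
    rw [integral_chi hb0.le hyL.1, min_eq_right hy.1] at h2
    have h3 := hMb y hyL
    have h4 : m₀ * y ≤ b := mul_le_mul_of_nonneg_left hy.2 hm₀.le
    have h5 : 0 ≤ m₀ * y := mul_nonneg hm₀.le hyL.1
    have h6 := abs_deriv_mul_sub_le hm₀ he0 he' hb0.le (hθe y hyL) (hP1 y hyL)
      (p := μ * θ' y) (X := m₀ * y - M y) (Y := m₀ * y - b)
      (abs_le.2 ⟨by linarith [h3.1, h3.2], by linarith [h3.1, h3.2]⟩)
      (abs_le.2 ⟨by linarith, by linarith⟩)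
      (by rwa [show m₀ * (m₀ * y - M y) = m₀ ^ 2 * y - m₀ * M y by ring]) h2
    have h7 := (abs_le.1 h6).2
    linarith
  have hderivc : Continuous fun y => θ' y * P y + θ y * P' y :=
    (hθ.continuous_deriv.mul hP.continuous).add (hθ.continuous.mul hP.continuous_deriv)
  have hFTC : ∫ y in b..x, (θ' y * P y + θ y * P' y) = θ x * P x - θ b * P b :=
    intervalIntegral.integral_eq_sub_of_hasDerivAt
      (fun y _ => (hθ.hasDerivAt y).mul (hP.hasDerivAt y)) (hderivc.intervalIntegrable _ _)
  have hbound : μ * (θ x * P x - θ b * P b) ≤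
      m₀ * (m₀ * (x ^ 2 - b ^ 2) - b * (x - b) - ∫ y in b..x, M y) + 500 * e * m₀ * b * (x - b) := by
    rw [← hFTC, ← intervalIntegral.integral_const_mul]
    have hi : ∀ k : ℝ, IntervalIntegrable (fun _ : ℝ => k) volume b x := fun k => by simp
    have hid : IntervalIntegrable (fun y : ℝ => y) volume b x := continuous_id.intervalIntegrable _ _
    have hiM : IntervalIntegrable M volume b x := hMc.intervalIntegrable _ _
    have h1 : ∫ y in b..x, μ * (θ' y * P y + θ y * P' y) ≤
        ∫ y in b..x, (m₀ * (2 * m₀ * y - b - M y) + 500 * e * m₀ * b) :=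
      intervalIntegral.integral_mono_on hx.1.le ((hderivc.intervalIntegrable _ _).const_mul μ)
        (((((hid.const_mul _).sub (hi b)).sub hiM).const_mul m₀).add (hi _))
        fun y hy => hderiv y ⟨hy.1, hy.2.trans hx.2⟩
    refine h1.trans_eq ?_
    rw [intervalIntegral.integral_add ((((hid.const_mul _).sub (hi b)).sub hiM).const_mul m₀) (hi _),
      intervalIntegral.integral_const_mul, intervalIntegral.integral_sub
        ((hid.const_mul _).sub (hi b)) hiM, intervalIntegral.integral_sub (hid.const_mul _) (hi b),
      intervalIntegral.integral_const_mul, integral_id]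
    simp only [intervalIntegral.integral_const, smul_eq_mul]
    ring
  have hxb : 0 < x - b := by linarith [hx.1]
  -- Since `b = m₀ L`, the explicit part factors as `m₀ (x - b)(x + b - L)`, which is negative
  -- except near the right end.
  have hkey : m₀ * (x ^ 2 - b ^ 2) - b * (x - b) - (∫ y in b..x, M y) + 500 * e * b * (x - b) < 0 := by
    have hfac : m₀ * (x ^ 2 - b ^ 2) - b * (x - b) = m₀ * ((x - b) * (x + b - L)) := by
      rw [hb]; ring
    have herr : 500 * e * b * (x - b) ≤ b * (x - b) / 20 := by
      have := mul_pos hb0 hxb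
      nlinarith
    have hMi : ∀ s t, IntervalIntegrable M volume s t := fun s t => hMc.intervalIntegrable s t
    -- For `x ≤ 3L/4` the explicit part is at most `-b (x - b) / 8` and beats the error `b (x - b) /
    -- 20`. For larger `x` it may be positive, but is at most `b²`; there `hleft` gives `∫ M ≥ bL/2
    -- - b² - bL/4` over `(b, x)`, which dominates.
    rcases le_or_gt x (3 / 4 * L) with hx34 | hx34
    · have hMnn : 0 ≤ ∫ y in b..x, M y := intervalIntegral.integral_nonneg hx.1.le fun y hy =>
        (hMb y ⟨hb0.le.trans hy.1, hy.2.trans hx.2⟩).1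
      have h1 : (x - b) * (x + b - L) ≤ (x - b) * (-(L / 8)) :=
        mul_le_mul_of_nonneg_left (by linarith) hxb.le
      have h2 := mul_le_mul_of_nonneg_left h1 hm₀.le
      have h3 : m₀ * ((x - b) * (-(L / 8))) = -(b * (x - b) / 8) := by rw [hb]; ring
      have h4 := mul_pos hb0 hxb
      linarith
    · have h1 : ∫ y in (0 : ℝ)..b, M y ≤ b * b := by
        have : ∫ y in (0 : ℝ)..b, M y ≤ ∫ y in (0 : ℝ)..b, b :=
          intervalIntegral.integral_mono_on hb0.le (hMi _ _) (by simp) fun y hy =>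
            (hMb y ⟨hy.1, by linarith [hy.2]⟩).2
        simpa using this
      have h2 : ∫ y in x..L, M y ≤ (L - x) * b := by
        have : ∫ y in x..L, M y ≤ ∫ y in x..L, b :=
          intervalIntegral.integral_mono_on hx.2 (hMi _ _) (by simp) fun y hy =>
            (hMb y ⟨by linarith [hy.1, hx.1], hy.2⟩).2
        simpa using this
      have h3 := intervalIntegral.integral_add_adjacent_intervals (hMi 0 b) (hMi b x)
      have h4 := intervalIntegral.integral_add_adjacent_intervals (hMi 0 x) (hMi x L)
      have h5 : m₀ * L ^ 2 / 2 = b * L / 2 := by rw [hb]; ring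
      have h6 : (L - x) * b ≤ b * L / 4 := by nlinarith
      have h7 : b * b ≤ b * (L / 10000) := mul_le_mul_of_nonneg_left hbL hb0.le
      have h8 : m₀ * ((x - b) * (x + b - L)) ≤ b * b := by
        have : (x - b) * (x + b - L) ≤ L * b :=
          (mul_le_mul_of_nonneg_left (by linarith [hx.2] : x + b - L ≤ b) hxb.le).trans
            (mul_le_mul_of_nonneg_right (by linarith [hx.2]) hb0.le)
        calc m₀ * ((x - b) * (x + b - L)) ≤ m₀ * (L * b) := mul_le_mul_of_nonneg_left this hm₀.le
          _ = b * b := by rw [hb]; ring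
      have h9 : b * (x - b) ≤ b * L := mul_le_mul_of_nonneg_left (by linarith [hx.2]) hb0.le
      have h10 := mul_pos hb0 hL
      linarith
  have hfin : μ * (θ x * P x - θ b * P b) < 0 := by
    have := mul_neg_of_pos_of_neg hm₀ hkey
    linarith
  have := (pos_iff_neg_of_mul_neg hfin).1 hμ
  linarith

/-! ### Comparison with the left-concentrated resource -/

/-- A resource that is mostly in the left half supports at most the population of `chi`. -/
theorem IsRegularEquilibrium.integral_le_of_left {L μ m₀ e : ℝ} (hL : 0 < L) (hμ : 0 < μ)
    (hm₀ : 0 < m₀) (hm₀' : m₀ ≤ 1 / 10000) (he : m₀ * L ^ 2 = e * μ) (he' : e ≤ 1 / 10000)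
    {m θ θ' ψ ψ' : ℝ → ℝ} (hm : Measurable m) (hm01 : ∀ x, 0 ≤ m x ∧ m x ≤ 1)
    (hmi : ∫ x in (0 : ℝ)..L, m x = m₀ * L)
    (hleft : m₀ * L ^ 2 / 2 ≤ ∫ x in (0 : ℝ)..L, ∫ t in (0 : ℝ)..x, m t)
    (hθ : IsRegularEquilibrium L μ m θ θ') (hψ : IsRegularEquilibrium L μ (chi (m₀ * L)) ψ ψ') :
    ∫ x in (0 : ℝ)..L, θ x ≤ ∫ x in (0 : ℝ)..L, ψ x ∧
      (∫ x in (0 : ℝ)..L, θ x = ∫ x in (0 : ℝ)..L, ψ x →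
        ∀ᵐ x ∂(vol L), m x = chi (m₀ * L) x) := by
  have he0 : 0 < e := pos_of_mul_pos_left (he ▸ by positivity) hμ.le
  have hb0 : 0 < m₀ * L := by positivity
  have hbL : m₀ * L ≤ L := by nlinarith
  have hni : ∫ x in (0 : ℝ)..L, chi (m₀ * L) x = m₀ * L := by
    rw [integral_chi hb0.le hL.le, min_eq_right hbL]
  set b := m₀ * L with hb
  have hθc := hθ.continuous
  have hψc := hψ.continuous
  have hic : ∀ s t, IntervalIntegrable (chi b) volume s t :=
    intervalIntegrable_of_measurable (measurable_chi b) (chi_mem b)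
  have him : ∀ s t, IntervalIntegrable m volume s t := intervalIntegrable_of_measurable hm hm01
  have hθe := hθ.abs_sub_le hL hμ hm₀ he (by linarith) hm hm01 hmi
  have hψe := hψ.abs_sub_le hL hμ hm₀ he (by linarith) (measurable_chi b) (chi_mem b) hni
  have hai : ∀ s t, IntervalIntegrable (fun x => ψ x + θ x - chi b x) volume s t := fun s t =>
    ((hψc.add hθc).intervalIntegrable s t).sub (hic s t)
  have hsmall : 3 * e * m₀ ≤ m₀ := by nlinarith
  -- The constant `5` is `4` from `ψ + θ ≤ 4 m₀` plus `1` from the integral of `chi b`. The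
  -- smallness required of the adjoint problem becomes `10 e ≤ 1/4`.
  have hA : ∫ x in (0 : ℝ)..L, |ψ x + θ x - chi b x| ≤ 5 * b := by
    have h1 : ∫ x in (0 : ℝ)..L, |ψ x + θ x - chi b x| ≤ ∫ x in (0 : ℝ)..L, (4 * m₀ + chi b x) :=
      intervalIntegral.integral_mono_on hL.le (hai 0 L).abs ((by simp :
        IntervalIntegrable (fun _ => 4 * m₀) volume 0 L).add (hic 0 L)) fun x hx => by
          have h2 := abs_le.1 (hθe x hx)
          have h3 := abs_le.1 (hψe x hx)
          have h4 := hθ.nonneg x hx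
          have h5 := hψ.nonneg x hx
          have h6 := chi_mem b x
          rw [abs_le]
          constructor <;> linarith [h2.2, h3.2, h6.1]
    rw [intervalIntegral.integral_add (by simp) (hic 0 L), hni] at h1
    simp only [intervalIntegral.integral_const, smul_eq_mul, sub_zero] at h1
    linarith
  obtain ⟨P, P', κ, hP, hP1⟩ := exists_adjoint hL hμ hai hA (by
    rw [div_mul_eq_mul_div, div_le_iff₀ hμ]
    nlinarith)
  have hP1' : ∀ x ∈ Icc 0 L, |P x - 1| ≤ 20 * e := fun x hx => by
    refine (hP1 x hx).trans_eq ?_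
    rw [div_mul_eq_mul_div, div_eq_iff hμ.ne']
    linear_combination 20 * he
  have hκ : 0 < κ := by
    have h1 := (hP.abs_deriv_sub_le hL hm₀ he0.le (measurable_chi b) (chi_mem b) hni hθc hψc
      hθe hψe hA hP1').1
    have h2 := (abs_le.1 h1).1
    nlinarith
  have hanti := strictAntiOn_mul hμ hm₀ hm₀' he' hbL hm hm01 hθ hψc hP hκ.le hθe hψe hP1'
  have hgreen := hP.mul_integral_sub hL hm hm01 (measurable_chi b) (chi_mem b) hθ hψ
  have hhc : Continuous fun x => θ x * P x := hθc.mul hP.continuous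
  set h := fun x => θ x * P x with hh
  have hlt : ∀ x ∈ Ioo b L, h x < h b := fun x hx =>
    mul_lt_of_mem_Ioc hL hμ hm₀ hm₀' he0.le he' hm hm01 hmi hleft hθ hψc hP hA hθe hψe hP1'
      ⟨hx.1, hx.2.le⟩
  have hgt : ∀ x ∈ Ioo 0 b, h b < h x := fun x hx =>
    hanti ⟨hx.1.le, hx.2.le⟩ ⟨hb0.le, le_rfl⟩ hx.2
  have hdi : ∀ s t, IntervalIntegrable (fun x => chi b x - m x) volume s t := fun s t =>
    (hic s t).sub (him s t)
  have hfi : IntervalIntegrable (fun x => (chi b x - m x) * (h x - h b)) volume 0 L :=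
    (hdi 0 L).mul_continuousOn (hhc.sub continuous_const).continuousOn
  -- Both resources have integral `b`, so the constant `h b` may be subtracted from `h`. The
  -- integrand then has a sign, and vanishes only where the resources agree, apart from the point
  -- `b`.
  have hshift : ∫ x in (0 : ℝ)..L, (chi b x - m x) * h x =
      ∫ x, (chi b x - m x) * (h x - h b) ∂(vol L) := by
    rw [integral_vol hL]
    have h1 : ∫ x in (0 : ℝ)..L, (chi b x - m x) * h b = 0 := by
      rw [intervalIntegral.integral_mul_const, intervalIntegral.integral_sub (hic 0 L) (him 0 L),
        hni, hmi, sub_self, zero_mul]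
    have h2 := intervalIntegral.integral_sub ((hdi 0 L).mul_continuousOn hhc.continuousOn)
      ((hdi 0 L).mul_const (h b))
    rw [h1, sub_zero] at h2
    rw [← h2]
    congr 1; ext x; ring
  have hcases : ∀ x ∈ Ioo 0 L, 0 ≤ (chi b x - m x) * (h x - h b) ∧
      ((chi b x - m x) * (h x - h b) = 0 → x ≠ b → m x = chi b x) := by
    intro x hx
    rcases lt_trichotomy x b with hxb | hxb | hxb
    · have h1 : chi b x = 1 := indicator_of_mem (show x ∈ Ioo 0 b from ⟨hx.1, hxb⟩) _
      have h2 := sub_pos.2 (hgt x ⟨hx.1, hxb⟩)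
      rw [h1]
      refine ⟨mul_nonneg (by linarith [(hm01 x).2]) h2.le, fun h0 _ => ?_⟩
      have := (mul_eq_zero.1 h0).resolve_right h2.ne'
      linarith
    · subst hxb
      simp
    · have h1 : chi b x = 0 := indicator_of_notMem
        (show x ∉ Ioo 0 b from fun h => lt_asymm hxb h.2) _
      have h2 := sub_neg.2 (hlt x ⟨hxb, hx.2⟩)
      rw [h1]
      refine ⟨mul_nonneg_of_nonpos_of_nonpos (by linarith [(hm01 x).1]) h2.le, fun h0 _ => ?_⟩
      have := (mul_eq_zero.1 h0).resolve_right h2.ne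
      linarith
  have hnn : ∀ᵐ x ∂(vol L), 0 ≤ (chi b x - m x) * (h x - h b) :=
    ae_vol_of_forall fun x hx => (hcases x hx).1
  rw [hshift, intervalIntegral.integral_sub (hψc.intervalIntegrable _ _)
    (hθc.intervalIntegrable _ _)] at hgreen
  refine ⟨?_, fun heq => ?_⟩
  · have h1 := integral_nonneg_of_ae hnn
    rw [← hgreen] at h1
    linarith [nonneg_of_mul_nonneg_right h1 hκ]
  · rw [heq, sub_self, mul_zero] at hgreen
    have h1 := (integral_eq_zero_iff_of_nonneg_ae hnn ((integrable_vol_iff hL).2 hfi)).1 hgreen.symm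
    have h2 : ∀ᵐ x ∂(vol L), x ≠ b := ae_restrict_of_ae (by simp [ae_iff])
    filter_upwards [h1, h2, ae_vol_of_forall (L := L) (p := fun x => x ∈ Ioo 0 L) fun x hx => hx]
      with x hx1 hx2 hx3
    exact (hcases x hx3).2 hx1 hx2

/-! ### Reflection of the interval -/

theorem measurePreserving_reflect (L : ℝ) :
    MeasurePreserving (fun x => L - x) (vol L) (vol L) := by
  have h := ((volume : Measure ℝ).measurePreserving_sub_left L).restrict_preimage
    (measurableSet_Ioo (a := (0 : ℝ)) (b := L))
  rw [preimage_const_sub_Ioo, sub_self, sub_zero] at h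
  exact h

theorem integral_reflect (L : ℝ) (f : ℝ → ℝ) :
    ∫ x, f (L - x) ∂(vol L) = ∫ x, f x ∂(vol L) :=
  (measurePreserving_reflect L).integral_comp (MeasurableEquiv.subLeft L).measurableEmbedding f

theorem ae_reflect {L : ℝ} {p : ℝ → Prop} (h : ∀ᵐ x ∂(vol L), p x) :
    ∀ᵐ x ∂(vol L), p (L - x) :=
  (measurePreserving_reflect L).quasiMeasurePreserving.ae h

theorem contDiff_reflect {L : ℝ} {φ : ℝ → ℝ} (hφ : ContDiff ℝ ∞ φ) :
    ContDiff ℝ ∞ fun x => φ (L - x) :=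
  hφ.comp (contDiff_const.sub contDiff_id)

theorem deriv_reflect {L : ℝ} {φ : ℝ → ℝ} (x : ℝ) :
    deriv (fun x => φ (L - x)) x = -deriv φ (L - x) :=
  deriv_comp_const_sub φ L x

theorem IsEquilibrium.reflect {L μ : ℝ} {m θ : ℝ → ℝ} (h : IsEquilibrium L μ m θ) :
    IsEquilibrium L μ (fun x => m (L - x)) (fun x => θ (L - x)) := by
  obtain ⟨hθ, hnn, hnz, g, hg, hwd, hweak⟩ := h
  refine ⟨hθ.comp_measurePreserving (measurePreserving_reflect L), ae_reflect hnn, fun h0 => hnz ?_,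
    fun x => -g (L - x), (hg.comp_measurePreserving (measurePreserving_reflect L)).neg,
    fun φ hφ hφc hφs => ?_, fun φ hφ => ?_⟩
  · filter_upwards [ae_reflect h0] with x hx
    simpa using hx
  · have h1 := hwd (fun x => φ (L - x)) (contDiff_reflect hφ)
      (hφc.comp_homeomorph (Homeomorph.subLeft L)) (by
        have : tsupport (fun x => φ (L - x)) = (fun x => L - x) ⁻¹' tsupport φ :=
          tsupport_comp_eq_preimage φ (Homeomorph.subLeft L)
        rw [this]
        intro x hx
        have := hφs hx
        exact ⟨by linarith [this.2], by linarith [this.1]⟩)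
    rw [← integral_reflect, ← integral_reflect L (fun x => g x * φ (L - x))] at h1
    simp only [deriv_reflect, sub_sub_cancel, mul_neg, integral_neg] at h1
    simp only [neg_mul, integral_neg]
    linarith
  · have h1 := hweak (fun x => φ (L - x)) (contDiff_reflect hφ)
    rw [← integral_reflect, ← integral_reflect L (fun x => θ x * (m x - θ x) * φ (L - x))] at h1
    simp only [deriv_reflect, sub_sub_cancel, mul_neg] at h1
    simpa only [neg_mul] using h1

theorem IsEquilibrium.congr {L μ : ℝ} {m n θ : ℝ → ℝ} (h : IsEquilibrium L μ m θ)
    (hmn : ∀ᵐ x ∂(vol L), m x = n x) : IsEquilibrium L μ n θ := by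
  obtain ⟨hθ, hnn, hnz, g, hg, hwd, hweak⟩ := h
  refine ⟨hθ, hnn, hnz, g, hg, hwd, fun φ hφ => ?_⟩
  rw [hweak φ hφ]
  apply integral_congr_ae
  filter_upwards [hmn] with x hx
  rw [hx]

/-- The first moments of a resource and of its reflection add up to the total. -/
theorem integral_primitive_reflect {L : ℝ} {m : ℝ → ℝ}
    (him : ∀ s t, IntervalIntegrable m volume s t) :
    ∫ x in (0 : ℝ)..L, ∫ t in (0 : ℝ)..x, m (L - t) =
      (∫ t in (0 : ℝ)..L, m t) * L - ∫ x in (0 : ℝ)..L, ∫ t in (0 : ℝ)..x, m t := by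
  have hMc : Continuous fun x => ∫ t in (0 : ℝ)..x, m t :=
    intervalIntegral.continuous_primitive him 0
  have h1 : ∀ x, ∫ t in (0 : ℝ)..x, m (L - t) =
      (∫ t in (0 : ℝ)..L, m t) - ∫ t in (0 : ℝ)..(L - x), m t := by
    intro x
    rw [intervalIntegral.integral_comp_sub_left, sub_zero,
      intervalIntegral.integral_interval_sub_left (him _ _) (him _ _)]
  simp only [h1]
  have h2 := intervalIntegral.integral_comp_sub_left (a := 0) (b := L)
    (fun x => ∫ t in (0 : ℝ)..x, m t) L
  rw [sub_self, sub_zero] at h2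
  have hrc : Continuous fun x => ∫ t in (0 : ℝ)..(L - x), m t :=
    hMc.comp (continuous_const.sub continuous_id)
  rw [intervalIntegral.integral_sub (by simp) (hrc.intervalIntegrable _ _), h2]
  simp [mul_comm]

/-! ### Comparison for arbitrary resources -/

theorem exists_measurable_representative {L : ℝ} {m : ℝ → ℝ}
    (hm : AEStronglyMeasurable m (vol L)) (hm01 : ∀ᵐ x ∂(vol L), 0 ≤ m x ∧ m x ≤ 1) :
    ∃ n : ℝ → ℝ, Measurable n ∧ (∀ x, 0 ≤ n x ∧ n x ≤ 1) ∧ ∀ᵐ x ∂(vol L), m x = n x := by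
  refine ⟨fun x => max 0 (min 1 (hm.mk m x)),
    measurable_const.max (measurable_const.min hm.stronglyMeasurable_mk.measurable),
    fun x => ⟨le_max_left _ _, max_le zero_le_one (min_le_left _ _)⟩, ?_⟩
  filter_upwards [hm.ae_eq_mk, hm01] with x h1 h2
  rw [← h1, min_eq_right h2.2, max_eq_right h2.1]

/-- The population supported by any small resource is at most that supported by `chi`, with
equality only for `chi` and its reflection. -/
theorem IsEquilibrium.integral_le {L μ m₀ e : ℝ} (hL : 0 < L) (hμ : 0 < μ) (hm₀ : 0 < m₀)
    (hm₀' : m₀ ≤ 1 / 10000) (he : m₀ * L ^ 2 = e * μ) (he' : e ≤ 1 / 10000) {m θ ψ : ℝ → ℝ}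
    (hm : m ∈ resources L m₀) (hθ : IsEquilibrium L μ m θ)
    (hψ : IsEquilibrium L μ (chi (m₀ * L)) ψ) :
    ∫ x, θ x ∂(vol L) ≤ ∫ x, ψ x ∂(vol L) ∧ (∫ x, θ x ∂(vol L) = ∫ x, ψ x ∂(vol L) →
      (∀ᵐ x ∂(vol L), m x = chi (m₀ * L) x) ∨ ∀ᵐ x ∂(vol L), m x = chi (m₀ * L) (L - x)) := by
  obtain ⟨hmL, hm01, hmean⟩ := hm
  obtain ⟨n, hn, hn01, hmn⟩ := exists_measurable_representative hmL.aestronglyMeasurable hm01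
  have hni : ∫ x in (0 : ℝ)..L, n x = m₀ * L := by
    rw [← integral_vol hL, ← integral_congr_ae hmn, ← hmean]
    field_simp
  have hin : ∀ s t, IntervalIntegrable n volume s t := intervalIntegrable_of_measurable hn hn01
  obtain ⟨Ψ, Ψ', hΨ, hψΨ⟩ := hψ.exists_regular hL hμ (measurable_chi _) (chi_mem _)
  have main : ∀ k ϑ : ℝ → ℝ, Measurable k → (∀ x, 0 ≤ k x ∧ k x ≤ 1) →
      ∫ x in (0 : ℝ)..L, k x = m₀ * L →
      m₀ * L ^ 2 / 2 ≤ (∫ x in (0 : ℝ)..L, ∫ t in (0 : ℝ)..x, k t) → IsEquilibrium L μ k ϑ →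
      ∫ x, ϑ x ∂(vol L) ≤ ∫ x, ψ x ∂(vol L) ∧ (∫ x, ϑ x ∂(vol L) = ∫ x, ψ x ∂(vol L) →
        ∀ᵐ x ∂(vol L), k x = chi (m₀ * L) x) := by
    intro k ϑ hk hk01 hki hleft hϑ
    obtain ⟨Θ, Θ', hΘ, hϑΘ⟩ := hϑ.exists_regular hL hμ hk hk01
    rw [integral_congr_ae hψΨ, integral_congr_ae hϑΘ, integral_vol hL, integral_vol hL]
    exact hΘ.integral_le_of_left hL hμ hm₀ hm₀' he he' hk hk01 hki hleft hΨ
  -- The first moments of `n` and of its reflection add up to `m₀ L²`, so at least one of the two is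
  -- at least half of that. Reflection preserves the total population.
  rcases le_or_gt (m₀ * L ^ 2 / 2) (∫ x in (0 : ℝ)..L, ∫ t in (0 : ℝ)..x, n t) with hleft | hright
  · obtain ⟨h1, h2⟩ := main n θ hn hn01 hni hleft (hθ.congr hmn)
    refine ⟨h1, fun heq => Or.inl ?_⟩
    filter_upwards [h2 heq, hmn] with x hx1 hx2
    rw [hx2, hx1]
  · obtain ⟨h1, h2⟩ := main (fun x => n (L - x)) (fun x => θ (L - x))
      (hn.comp (measurable_const.sub measurable_id)) (fun x => hn01 _)
      (by rw [← integral_vol hL, integral_reflect, integral_vol hL, hni])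
      (by rw [integral_primitive_reflect hin, hni]; linarith) (hθ.congr hmn).reflect
    rw [integral_reflect] at h1 h2
    refine ⟨h1, fun heq => Or.inr ?_⟩
    filter_upwards [ae_reflect (h2 heq), hmn] with x hx1 hx2
    rw [sub_sub_cancel] at hx1
    rw [hx2, hx1]

/-! ### The total population and the theorem -/

/-- The total population belongs to some chosen equilibrium. Since `IsEquilibrium.integral_le` holds
for all equilibria, it does not matter which one was chosen. -/
theorem exists_isEquilibrium_totalPopulation_eq {L μ : ℝ} {m : ℝ → ℝ}
    (h : ∃ θ, IsEquilibrium L μ m θ) :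
    ∃ θ, IsEquilibrium L μ m θ ∧ totalPopulation L μ m = ∫ x, θ x ∂(vol L) :=
  ⟨h.choose, h.choose_spec, by rw [totalPopulation, equilibrium, dif_pos h]⟩

theorem IsEquilibrium.integral_pos {L μ : ℝ} {m θ : ℝ → ℝ} (h : IsEquilibrium L μ m θ) :
    0 < ∫ x, θ x ∂(vol L) := by
  obtain ⟨hθ, hnn, hnz, -⟩ := h
  refine lt_of_le_of_ne (integral_nonneg_of_ae hnn) fun h0 => hnz ?_
  exact (integral_eq_zero_iff_of_nonneg_ae hnn (hθ.integrable (by norm_num))).1 h0.symm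

theorem mem_resources_of_ae_eq {L m₀ : ℝ} {m n : ℝ → ℝ} (hn : n ∈ resources L m₀)
    (h : ∀ᵐ x ∂(vol L), m x = n x) : m ∈ resources L m₀ := by
  obtain ⟨h1, h2, h3⟩ := hn
  refine ⟨h1.ae_eq (by filter_upwards [h] with x hx using hx.symm), ?_, ?_⟩
  · filter_upwards [h, h2] with x hx1 hx2
    rwa [hx1]
  · rwa [integral_congr_ae h]

theorem chi_mem_resources {L m₀ : ℝ} (hL : 0 < L) (hm₀ : 0 < m₀) (hm₀' : m₀ ≤ 1) :
    chi (m₀ * L) ∈ resources L m₀ := by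
  refine ⟨MemLp.of_bound (measurable_chi _).aestronglyMeasurable 1 ?_,
    Filter.Eventually.of_forall fun x => chi_mem _ x, ?_⟩
  · refine Filter.Eventually.of_forall fun x => ?_
    rw [Real.norm_eq_abs, abs_of_nonneg (chi_mem _ x).1]
    exact (chi_mem _ x).2
  · rw [integral_vol hL, integral_chi (by positivity) hL.le, min_eq_right (by nlinarith)]
    field_simp

theorem reflect_mem_resources {L m₀ : ℝ} {m : ℝ → ℝ} (hm : m ∈ resources L m₀) :
    (fun x => m (L - x)) ∈ resources L m₀ := by
  obtain ⟨h1, h2, h3⟩ := hm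
  refine ⟨h1.comp_measurePreserving (measurePreserving_reflect L), ae_reflect h2, ?_⟩
  rwa [integral_reflect]

end LogisticControl

end

theorem mainTheorem2 (L μ : ℝ) (hL : 0 < L) (hμ : 0 < μ) :
    ∃ m₁ : ℝ, 0 < m₁ ∧ m₁ < 1 ∧ ∀ m₀ : ℝ, 0 < m₀ → m₀ < m₁ → ∀ m : ℝ → ℝ,
      LogisticControl.IsOptimalControl L μ m₀ m ↔
        (∀ᵐ x ∂(LogisticControl.vol L), m x = LogisticControl.chi (m₀ * L) x) ∨
        (∀ᵐ x ∂(LogisticControl.vol L), m x = LogisticControl.chi (m₀ * L) (L - x)) := by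
  open LogisticControl in
  -- The two terms of the minimum ensure `m₀ ≤ 1/10000` and `e = m₀ L² / μ ≤ 1/10000`.
  refine ⟨min (1 / 10000) (μ / (10000 * L ^ 2)), lt_min (by norm_num) (by positivity),
    (min_le_left _ _).trans_lt (by norm_num), fun m₀ hm₀ hlt m => ?_⟩
  have hm₀' : m₀ ≤ 1 / 10000 := hlt.le.trans (min_le_left _ _)
  obtain ⟨e, he, he'⟩ : ∃ e, m₀ * L ^ 2 = e * μ ∧ e ≤ 1 / 10000 := by
    refine ⟨m₀ * L ^ 2 / μ, (div_mul_cancel₀ _ hμ.ne').symm, ?_⟩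
    have h1 : m₀ ≤ μ / (10000 * L ^ 2) := hlt.le.trans (min_le_right _ _)
    rw [le_div_iff₀ (by positivity)] at h1
    rw [div_le_iff₀ hμ]
    linarith
  have hχ := chi_mem_resources hL hm₀ (by linarith : m₀ ≤ 1)
  obtain ⟨ψ, ψ', hψr⟩ := exists_isRegularEquilibrium hL hμ hm₀ he (by linarith)
    (measurable_chi (m₀ * L)) (chi_mem _) (by
      rw [integral_chi (by positivity) hL.le, min_eq_right (by nlinarith)])
  have hψ := hψr.isEquilibrium hL (measurable_chi (m₀ * L)) (chi_mem _)
  have hle : ∀ n ∈ resources L m₀, totalPopulation L μ n ≤ ∫ x, ψ x ∂(vol L) ∧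
      (totalPopulation L μ n = ∫ x, ψ x ∂(vol L) →
        (∀ᵐ x ∂(vol L), n x = chi (m₀ * L) x) ∨ ∀ᵐ x ∂(vol L), n x = chi (m₀ * L) (L - x)) := by
    intro n hn
    by_cases hex : ∃ θ, IsEquilibrium L μ n θ
    · obtain ⟨θ, hθ, hθn⟩ := exists_isEquilibrium_totalPopulation_eq hex
      rw [hθn]
      exact hθ.integral_le hL hμ hm₀ hm₀' he he' hn hψ
    -- If a resource had no equilibrium, its population would be the default value `0`, which is
    -- below the positive total of `ψ`. Existence is thus needed only for `chi`.
    · have h0 : totalPopulation L μ n = 0 := by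
        rw [totalPopulation, equilibrium, dif_neg hex]
        simp
      have hpos := hψ.integral_pos
      rw [h0]
      exact ⟨hpos.le, fun h => absurd h hpos.ne⟩
  have hge : ∀ n, (∀ᵐ x ∂(vol L), n x = chi (m₀ * L) x) ∨
      (∀ᵐ x ∂(vol L), n x = chi (m₀ * L) (L - x)) →
      n ∈ resources L m₀ ∧ ∫ x, ψ x ∂(vol L) ≤ totalPopulation L μ n := by
    rintro n (hn | hn)
    · refine ⟨mem_resources_of_ae_eq hχ hn, ?_⟩
      obtain ⟨θ, hθ, hθn⟩ := exists_isEquilibrium_totalPopulation_eq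
        ⟨ψ, hψ.congr (by filter_upwards [hn] with x hx using hx.symm)⟩
      rw [hθn]
      -- The roles are exchanged: `ψ` is the competitor and the chosen `θ`, also an equilibrium of
      -- `chi`, is the reference. This replaces uniqueness of the equilibrium.
      exact (hψ.integral_le hL hμ hm₀ hm₀' he he' hχ (hθ.congr hn)).1
    · refine ⟨mem_resources_of_ae_eq (reflect_mem_resources hχ) hn, ?_⟩
      obtain ⟨θ, hθ, hθn⟩ := exists_isEquilibrium_totalPopulation_eq
        ⟨_, hψ.reflect.congr (by filter_upwards [hn] with x hx using hx.symm)⟩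
      have hθr := (hθ.congr hn).reflect
      simp only [sub_sub_cancel] at hθr
      rw [hθn, ← integral_reflect L θ]
      exact (hψ.integral_le hL hμ hm₀ hm₀' he he' hχ hθr).1
  constructor
  · rintro ⟨hm, hmax⟩
    obtain ⟨hχm, hχge⟩ := hge (chi (m₀ * L)) (Or.inl (Filter.Eventually.of_forall fun _ => rfl))
    have h1 : totalPopulation L μ (chi (m₀ * L)) ≤ totalPopulation L μ m := hmax hχm
    exact (hle m hm).2 (le_antisymm (hle m hm).1 (hχge.trans h1))
  · intro h
    obtain ⟨hm, hmge⟩ := hge m h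
    exact ⟨hm, fun n hn => (hle n hn).1.trans hmge⟩
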